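/- Assume CH. Call a topological space $X$ *relevant* if it is first countable, countably compact, non-compact, regular, $|X|=\aleph_1$, and $X$ has no uncountable free sequence (an $\omega_1$-sequence $(s_\alpha)$ of points with $\overline{\{s_\beta:\beta<\alpha\}}\cap\overline{\{s_\beta:\beta\ge\alpha\}}=\emptyset$ for all $\alpha<\omega_1$). For each relevant $X$ fix: a maximal (proper) filter $\mathcal U_X$ of closed subsets of $X$ with $\bigcap\mathcal U_X=\emptyset$; a set $Y_X\subseteq X$ that meets every $A\in\mathcal U_X$, has $Y_X\setminus A$ countable for every $A\in\mathcal U_X$, and is enumerated without repetition by $\omega_1$ so that initial segments are open in $Y_X$ (thus $\alpha<\omega_1$ is regarded as a point of $X$); and for each $\alpha<\omega_1$ a decreasing base $\{\mathcal B(X,\alpha,n):n\in\omega\}$ of open neighbourhoods of the point $\alpha$ in $X$. Let $\mathcal X=\{X_\xi:\xi<\kappa\}$ be a family of relevant spaces, and write $\mathcal U_\xi=\mathcal U_{X_\xi}$. A *promise* is a function $f$ from an uncountable subset of $\omega_1$ to $\omega$. For finite $v\subseteq\kappa$ let $\mathcal U_v$ be the filter of closed subsets of $X_v=\prod_{\xi\in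 v}X_\xi$ generated by the products $\prod_{\xi\in v}A_\xi$ with $A_\xi\in\mathcal U_\xi$. A point $(x_\xi)_{\xi\in v}$ of $X_v$ is banned by $(v,f)$ if $\{\alpha\in\operatorname{dom}f:\forall\xi\in v\; x_\xi\in\mathcal B(X_\xi,\alpha,f(\alpha))\}$ is countable. The family $\mathcal X$ is *safe* if for no finite $v\subseteq\kappa$ and no promise $f$ does the set of points banned by $(v,f)$ meet every member of $\mathcal U_v$. Conditions of $P(\mathcal X)$ are pairs $p=(a_p,\Phi_p)$ where $a_p$ is a function from a countable subset of $\{(\xi,x):\xi<\kappa,\ x\in X_\xi\}$ to $\{0,1\}$ such that for each $\xi$ the closure in $X_\xi$ of $[p]_\xi=\{x:a_p(\xi,x)=1\}$ is not in $\mathcal U_\xi$, and $\Phi_p$ is a countable set of pairs $(v,f)$ with $v\subseteq\kappa$ finite and $f$ a promise. Put $q\le p$ if $a_q\supseteq a_p$, $\Phi_q\supseteq\Phi_p$, and for every $(v,f)\in\Phi_p$ the set $Y=\{\alpha\in\operatorname{dom}f:\forall\xi\in v\;[q]_\xi\setminus[p]_\xi\subseteq\mathcal B(X_\xi,\alpha,f(\alpha))\}$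 is uncountable and $(v,f\restriction Y)\in\Phi_q$. A notion of forcing $P$ satisfies the *$\aleph_2$-properness isomorphism condition* ($\aleph_2$-p.i.c.) if there is a parameter $x$ such that for all large enough regular $\lambda$ the following holds. Whenever $i<j<\omega_2$; $N_i,N_j$ are countable elementary submodels of $(H(\lambda),\in)$ with $x,P\in N_i\cap N_j$, $i\in N_i$, $j\in N_j$, $N_i\cap\omega_2\subseteq j$, $N_i\cap i=N_j\cap j$; $h:N_i\to N_j$ is an isomorphism with $h(i)=j$ that is the identity on $N_i\cap N_j$; and $p\in N_i\cap P$; then there is a $q\in P$ that is $(N_i,P)$-generic and forces both $p\in\dot G$ and $(\forall r\in N_i\cap P)\,[\,r\in\dot G\leftrightarrow h(r)\in\dot G\,]$. **Theorem.** If $\mathcal X$ is a safe family of relevant spaces, then $P(\mathcal X)$ satisfies the $\aleph_2$-p.i.c. -/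

import Mathlib

open scoped FirstOrder

universe u

/-! ## Countable ordinals and free sequences -/

/-- The set `ω₁` of countable ordinals, as a well-ordered type. -/
abbrev OmegaOne : Type u := (Ordinal.omega 1 : Ordinal.{u}).ToType

/-- An uncountable free sequence: an `ω₁`-sequence of points such that at every stage the closure of
the earlier points is disjoint from the closure of the remaining ones. -/
def IsFreeSequence {X : Type u} [TopologicalSpace X] (s : OmegaOne.{u} → X) : Prop :=
  ∀ α, Disjoint (closure (s '' Set.Iio α)) (closure (s '' Set.Ici α))

/-- Relevant spaces. -/
structure IsRelevant (X : Type u) [TopologicalSpace X] : Prop where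
  firstCountable : FirstCountableTopology X
  countablyCompact : CountablyCompactSpace X
  notCompact : ¬ CompactSpace X
  regular : RegularSpace X
  card_eq : Cardinal.mk X = Cardinal.aleph 1
  no_free : ¬ ∃ s : OmegaOne.{u} → X, IsFreeSequence s

/-! ## Filters of closed sets -/

/-- Proper filters of closed subsets of `X`. -/
structure IsClosedFilter {X : Type u} [TopologicalSpace X] (F : Set (Set X)) : Prop where
  isClosed : ∀ A ∈ F, IsClosed A
  univ_mem : Set.univ ∈ F
  empty_notMem : ∅ ∉ F
  inter_mem : ∀ A ∈ F, ∀ B ∈ F, A ∩ B ∈ F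
  mem_of_superset : ∀ A ∈ F, ∀ B, IsClosed B → A ⊆ B → B ∈ F

/-- Maximal filters of closed sets. -/
def IsMaximalClosedFilter {X : Type u} [TopologicalSpace X] (F : Set (Set X)) : Prop :=
  IsClosedFilter F ∧ ∀ G : Set (Set X), IsClosedFilter G → F ⊆ G → G ⊆ F

/-- `Y` is `F`-large if it meets every member of `F`. -/
def IsLarge {X : Type u} (F : Set (Set X)) (Y : Set X) : Prop :=
  ∀ A ∈ F, (Y ∩ A).Nonempty

/-- `Y` diagonalizes `F` if it is `F`-large and almost contained (modulo countable sets) in every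
member of `F`. -/
def Diagonalizes {X : Type u} (F : Set (Set X)) (Y : Set X) : Prop :=
  IsLarge F Y ∧ ∀ A ∈ F, (Y \ A).Countable

/-- The auxiliary objects that are fixed for a relevant space `X`: a maximal filter `𝒰` of closed
sets that is not fixed; a subspace `Y` that diagonalizes `𝒰` and is right-separated in type `ω₁`,
given by its enumeration `pt` by the countable ordinals (so `pt α` is "`α` as a point of `X`");
and, for every countable ordinal `α`, a decreasing base `base α n` (`n ∈ ω`) of open neighbourhoods
of `α` as a point of `X`. -/
structure SpaceChoice (X : Type u) [TopologicalSpace X] where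
  filt : Set (Set X)
  filt_maximal : IsMaximalClosedFilter filt
  filt_not_fixed : ⋂₀ filt = ∅
  pt : OmegaOne.{u} → X
  pt_injective : Function.Injective pt
  diagonalizes : Diagonalizes filt (Set.range pt)
  right_separated : ∀ α, ∃ O : Set X, IsOpen O ∧ O ∩ Set.range pt = pt '' Set.Iio α
  base : OmegaOne.{u} → ℕ → Set X
  base_isOpen : ∀ α n, IsOpen (base α n)
  base_antitone : ∀ α, Antitone (base α)
  base_hasBasis : ∀ α, (nhds (pt α)).HasBasis (fun _ : ℕ => True) (base α)

/-! ## Promises and the poset `P(𝒳)` -/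

/-- The domain of a partial function from `ω₁` to `ω`. -/
def promiseDom (f : OmegaOne.{u} → Option ℕ) : Set OmegaOne.{u} := {α | f α ≠ none}

/-- A promise is a partial function from `ω₁` to `ω` with uncountable domain. -/
def IsPromise (f : OmegaOne.{u} → Option ℕ) : Prop := ¬ (promiseDom f).Countable

open Classical in
/-- The restriction `f ↾ Y` of a partial function. -/
noncomputable def restrictTo (f : OmegaOne.{u} → Option ℕ) (Y : Set OmegaOne.{u}) :
    OmegaOne.{u} → Option ℕ :=
  fun α => if α ∈ Y then f α else none

/-- The set `[a]_ξ` of those `x ∈ X_ξ` for which the partial function `a` has value `1`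
at `(ξ, x)`. -/
def sectionOf {ι : Type u} {X : ι → Type u} (a : (Σ ξ, X ξ) → Option Bool) (ξ : ι) :
    Set (X ξ) :=
  {x | a ⟨ξ, x⟩ = some true}

/-- The conditions of `P(𝒳)`. The first coordinate is a countable partial function
from `{(ξ, x) : x ∈ X_ξ}` to `2`. -/
@[ext] structure PX {ι : Type u} {X : ι → Type u} [∀ ξ, TopologicalSpace (X ξ)]
    (C : ∀ ξ, SpaceChoice (X ξ)) : Type u where
  a : (Σ ξ, X ξ) → Option Bool
  Φ : Set (Finset ι × (OmegaOne.{u} → Option ℕ))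
  a_countable : {z | a z ≠ none}.Countable
  closure_notMem : ∀ ξ, closure (sectionOf a ξ) ∉ (C ξ).filt
  Φ_countable : Φ.Countable
  Φ_promise : ∀ z ∈ Φ, IsPromise z.2

namespace PX

variable {ι : Type u} {X : ι → Type u} [∀ ξ, TopologicalSpace (X ξ)]
  {C : ∀ ξ, SpaceChoice (X ξ)}

/-- The set `Y(v, f, q, p)` of all `α ∈ dom f` such that `[q]_ξ ∖ [p]_ξ ⊆ 𝓑(X_ξ, α, f(α))` for
all `ξ ∈ v`. -/
def Y (v : Finset ι) (f : OmegaOne.{u} → Option ℕ) (q p : PX C) : Set OmegaOne.{u} :=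
  {α | ∃ n, f α = some n ∧
    ∀ ξ ∈ v, sectionOf q.a ξ \ sectionOf p.a ξ ⊆ (C ξ).base α n}

/-- `q` extends `p`. -/
def Extends (q p : PX C) : Prop :=
  (∀ z b, p.a z = some b → q.a z = some b) ∧ p.Φ ⊆ q.Φ ∧
    ∀ v f, (v, f) ∈ p.Φ →
      ¬ (Y v f q p).Countable ∧ (v, restrictTo f (Y v f q p)) ∈ q.Φ

theorem extends_refl (p : PX C) : Extends p p := by
  refine ⟨fun _ _ h => h, fun _ h => h, fun v f hf => ?_⟩
  have hY : Y v f p p = promiseDom f := by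
    ext α
    simp [Y, promiseDom, Option.ne_none_iff_exists']
  have hr : restrictTo f (promiseDom f) = f := by
    funext α
    by_cases h : f α = none <;> simp [restrictTo, promiseDom, h]
  rw [hY, hr]
  exact ⟨p.Φ_promise _ hf, hf⟩

theorem extends_trans {r q p : PX C} (hrq : Extends r q) (hqp : Extends q p) :
    Extends r p := by
  refine ⟨fun z b h => hrq.1 z b (hqp.1 z b h), hqp.2.1.trans hrq.2.1, fun v f hf => ?_⟩
  obtain ⟨_, h2⟩ := hqp.2.2 v f hf
  obtain ⟨h3, h4⟩ := hrq.2.2 v _ h2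
  have hpq : ∀ ξ, sectionOf p.a ξ ⊆ sectionOf q.a ξ := fun ξ x hx => hqp.1 _ _ hx
  have hqr : ∀ ξ, sectionOf q.a ξ ⊆ sectionOf r.a ξ := fun ξ x hx => hrq.1 _ _ hx
  have key : Y v (restrictTo f (Y v f q p)) r q = Y v f r p := by
    ext α
    constructor
    · rintro ⟨n, hn, hs⟩
      by_cases hα : α ∈ Y v f q p
      · have hfn : f α = some n := by simpa [restrictTo, hα] using hn
        refine ⟨n, hfn, fun ξ hξ x hx => ?_⟩
        obtain ⟨m, hm, hms⟩ := hα
        obtain rfl : m = n := by simpa [hm] using hfn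
        by_cases hxq : x ∈ sectionOf q.a ξ
        · exact hms ξ hξ ⟨hxq, hx.2⟩
        · exact hs ξ hξ ⟨hx.1, hxq⟩
      · simp [restrictTo, hα] at hn
    · rintro ⟨n, hn, hs⟩
      have hα : α ∈ Y v f q p :=
        ⟨n, hn, fun ξ hξ x hx => hs ξ hξ ⟨hqr ξ hx.1, hx.2⟩⟩
      exact ⟨n, by simpa [restrictTo, hα] using hn,
        fun ξ hξ x hx => hs ξ hξ ⟨hx.1, fun h => hx.2 (hpq ξ h)⟩⟩
  have key2 : restrictTo (restrictTo f (Y v f q p)) (Y v f r p) = restrictTo f (Y v f r p) := by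
    funext α
    by_cases hα : α ∈ Y v f r p
    · have h' := hα
      rw [← key] at h'
      obtain ⟨n, hn, _⟩ := h'
      by_cases hβ : α ∈ Y v f q p
      · simp [restrictTo, hα, hβ]
      · simp [restrictTo, hβ] at hn
    · simp [restrictTo, hα]
  rw [key] at h3 h4
  rw [key2] at h4
  exact ⟨h3, h4⟩

/-- `P(𝒳)` as a notion of forcing: `q ≤ p` means that `q` extends `p`. -/
instance : Preorder (PX C) where
  le q p := Extends q p
  le_refl := extends_refl
  le_trans _ _ _ h₁ h₂ := extends_trans h₁ h₂

end PX

/-! ## Safe families -/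

section Safe

variable {ι : Type u} {X : ι → Type u} [∀ ξ, TopologicalSpace (X ξ)]

/-- The filter `𝒰_v` of closed subsets of `X_v = ∏_{ξ ∈ v} X_ξ` generated by the products of members
of the `𝒰_ξ` (these products are closed under finite intersections). -/
def prodFilt (C : ∀ ξ, SpaceChoice (X ξ)) (v : Finset ι) : Set (Set (∀ ξ : v, X ξ)) :=
  {E | IsClosed E ∧ ∃ A : ∀ ξ : v, Set (X ξ),
    (∀ ξ : v, A ξ ∈ (C ξ).filt) ∧ Set.univ.pi A ⊆ E}

/-- The set of points of `X_v` that are banned by `(v, f)`. -/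
def banned (C : ∀ ξ, SpaceChoice (X ξ)) (v : Finset ι) (f : OmegaOne.{u} → Option ℕ) :
    Set (∀ ξ : v, X ξ) :=
  {x | {α | ∃ n, f α = some n ∧ ∀ ξ : v, x ξ ∈ (C ξ).base α n}.Countable}

/-- `v` is dangerous if the set of points banned by `(v, f)` is `𝒰_v`-large for some
promise `f`. -/
def IsDangerous (C : ∀ ξ, SpaceChoice (X ξ)) (v : Finset ι) : Prop :=
  ∃ f, IsPromise f ∧ IsLarge (prodFilt C v) (banned C v f)

/-- The family is safe if no finite set of indices is dangerous. -/
def IsSafe (C : ∀ ξ, SpaceChoice (X ξ)) : Prop :=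
  ∀ v : Finset ι, ¬ IsDangerous C v

end Safe

/-! ## `H(κ)`, its elementary submodels, and forcing -/

/-- The only symbol of the language of set theory: a binary relation symbol. -/
inductive MemRel : ℕ → Type
  | mem : MemRel 2

/-- The language of set theory. -/
def setLanguage : FirstOrder.Language.{0, 0} := ⟨fun _ => Empty, MemRel⟩

/-- `H(κ)`: the sets whose transitive closure has cardinality less than `κ`. -/
def HSet (κ : Cardinal.{u}) : Set ZFSet.{u} :=
  {x | ∃ T : ZFSet.{u}, T.IsTransitive ∧ x ⊆ T ∧ T.card < κ}

/-- `H(κ)` as a structure for the language of set theory, with the true membership relation. -/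
instance (κ : Cardinal.{u}) : setLanguage.Structure (HSet κ) where
  funMap := fun f _ => f.elim
  RelMap := fun {_} r => match r with
    | MemRel.mem => fun xs => ((xs 0 : HSet κ) : ZFSet.{u}) ∈ ((xs 1 : HSet κ) : ZFSet.{u})

/-- The elements of a submodel of `H(κ)`, as sets. -/
def elems {κ : Cardinal.{u}} (N : setLanguage.ElementarySubstructure (HSet κ)) :
    Set ZFSet.{u} :=
  {z | ∃ a : N, ((a : HSet κ) : ZFSet.{u}) = z}

/-- The isomorphism `h` satisfies `h(z) = w`, for `z ∈ N` and `w ∈ N'`. -/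
def IsoSends {κ : Cardinal.{u}} {N N' : setLanguage.ElementarySubstructure (HSet κ)}
    (h : N ≃[setLanguage] N') (z w : ZFSet.{u}) : Prop :=
  ∃ a : N, ((a : HSet κ) : ZFSet.{u}) = z ∧ ((h a : HSet κ) : ZFSet.{u}) = w

section Forcing

variable {P : Type u} [Preorder P]

/-- `q ⊩ r ∈ Ġ`. -/
def ForcesMem (q r : P) : Prop := ∀ q' ≤ q, ∃ s ≤ q', s ≤ r

/-- `q ⊩ (r ∈ Ġ ↔ r' ∈ Ġ)`. -/
def ForcesIff (q r r' : P) : Prop := ∀ q' ≤ q, (ForcesMem q' r ↔ ForcesMem q' r')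

/-- The set of codes of the elements of `D ⊆ P`, for a coding `c` of conditions by sets. -/
noncomputable def codeSet (c : P → ZFSet.{u}) (D : Set P) : ZFSet.{u} :=
  ZFSet.range fun d : D => c d

/-- The notion of forcing `(P, ≤)` as a set, for a coding `c` of conditions by sets. -/
noncomputable def codePoset (c : P → ZFSet.{u}) : ZFSet.{u} :=
  ZFSet.pair (codeSet c Set.univ)
    (ZFSet.range fun z : {z : P × P // z.1 ≤ z.2} => ZFSet.pair (c z.1.1) (c z.1.2))

/-- `q` is `(N, P)`-generic: every dense subset of `P` that belongs to `N` has its intersection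
with `N` predense below `q`. -/
def IsNGeneric (c : P → ZFSet.{u}) {κ : Cardinal.{u}}
    (N : setLanguage.ElementarySubstructure (HSet κ)) (q : P) : Prop :=
  ∀ D : Set P, (∀ p, ∃ d ∈ D, d ≤ p) → codeSet c D ∈ elems N →
    ∀ q' ≤ q, ∃ d ∈ D, c d ∈ elems N ∧ ∃ s, s ≤ q' ∧ s ≤ d

end Forcing

/-- The `ℵ₂`-properness isomorphism condition. Notions of forcing are types here, so the condition
is required of every copy of `P` whose conditions are sets (given by an injection `c`). The
submodels are those of `H(κ)`, for all large enough regular `κ`, that contain a fixed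
parameter `x`. -/
def AlephTwoPIC (P : Type u) [Preorder P] : Prop :=
  ∀ c : P → ZFSet.{u}, Function.Injective c →
  ∃ (x : ZFSet.{u}) (κ₀ : Cardinal.{u}), ∀ κ : Cardinal.{u}, κ₀ ≤ κ → κ.IsRegular →
  ∀ (i j : Ordinal.{u}) (Ni Nj : setLanguage.ElementarySubstructure (HSet κ))
    (h : Ni ≃[setLanguage] Nj) (p : P),
    i < j → j < Ordinal.omega 2 →
    (elems Ni).Countable → (elems Nj).Countable →
    x ∈ elems Ni → x ∈ elems Nj →
    i.toZFSet ∈ elems Ni → j.toZFSet ∈ elems Nj →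
    (∀ α : Ordinal.{u}, α < Ordinal.omega 2 → α.toZFSet ∈ elems Ni → α < j) →
    (∀ α : Ordinal.{u},
      (α.toZFSet ∈ elems Ni ∧ α < i) ↔ (α.toZFSet ∈ elems Nj ∧ α < j)) →
    IsoSends h i.toZFSet j.toZFSet →
    (∀ z, z ∈ elems Ni → z ∈ elems Nj → IsoSends h z z) →
    codePoset c ∈ elems Ni → codePoset c ∈ elems Nj →
    c p ∈ elems Ni →
    ∃ q : P,
      (∀ r r' : P, IsoSends h (c r) (c r') → ForcesIff q r r') ∧
      ForcesMem q p ∧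
      IsNGeneric c Ni q

/-! ### Absoluteness of pairs and graphs in `H(κ)`. -/

section SetFormulas

open FirstOrder FirstOrder.Language

variable {κ : Cardinal.{u}} {α : Type}

/-! One fusion, carried out inside `N_i`, is kept small for `N_i` and for its image `N_j` at the
same time. The two models have the same countable ordinals. A sequence of ordinals cofinal among
these is thinned until, for each index `ξ` in either model, the corresponding points of `X_ξ`
converge to some `x_ξ`; sequential compactness allows this. Then conditions `p_n` in `N_i` are built
that meet every dense set of `N_i`, while the new points of both `p_n` and `h(p_n)` fall into
shrinking neighbourhoods of the `x_ξ`.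

Two facts drive the steps. By `PX.exists_bound_forall_extension`, a condition can be extended into a
dense set with new points arbitrarily close to any point far along the enumerations: otherwise the
failures form a promise, and adding that promise is contradictory. By `IsSafe.exists_bound`, safety
prevents the limit `(x_ξ)` from being banned by a promise of either model, so a small enough
neighbourhood of the limit respects uncountably many `α` in its domain.

The extension is the value of a fixed choice function at arguments of `N_i`, among them an ordinal
and a natural number that `h` fixes. Hence `h` carries it to the corresponding extension of
`h(p_n)`, and one choice serves both sides (`exists_small_extension`).

Since `|X_ξ| = ℵ₁`, points of `X_ξ` are coded by countable ordinals. So for a common index both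
models contain the same points, `h` fixes them, and `p_n` and `h(p_n)` agree there.
`PX.exists_fusion` then gives a lower bound `q` of both sequences. Meeting the dense set that
decides `r` leaves `q` either below both `r` and `h(r)` or incompatible with both. -/

theorem HSet_mem_of_mem {x y : ZFSet.{u}} (hy : y ∈ HSet κ) (h : x ∈ y) : x ∈ HSet κ := by
  obtain ⟨T, hT, hyT, hc⟩ := hy
  exact ⟨T, hT, hT x (hyT h), hc⟩

/-- The symbol for membership. -/
def memSymbol : setLanguage.Relations 2 := MemRel.mem

/-- The formula `x ∈ y`. -/
def memFormula (x y : α) : setLanguage.Formula α :=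
  memSymbol.formula₂ (Term.var x) (Term.var y)

theorem realize_memFormula {x y : α} {v : α → HSet κ} :
    (memFormula x y).Realize v ↔ (v x : ZFSet.{u}) ∈ (v y : ZFSet.{u}) := by
  rw [memFormula, Formula.realize_rel₂]
  rfl

/-- The formula `z = {x, y}`. -/
noncomputable def unorderedFormula (z x y : α) : setLanguage.Formula α :=
  Formula.iAlls Unit ((memFormula (Sum.inr ()) (Sum.inl z)).iff
    (Term.equal (Term.var (Sum.inr ())) (Term.var (Sum.inl x)) ⊔
      Term.equal (Term.var (Sum.inr ())) (Term.var (Sum.inl y))))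

theorem realize_unorderedFormula {z x y : α} {v : α → HSet κ} :
    (unorderedFormula z x y).Realize v ↔
      (v z : ZFSet.{u}) = {(v x : ZFSet.{u}), (v y : ZFSet.{u})} := by
  rw [unorderedFormula, Formula.realize_iAlls]
  simp only [Formula.realize_iff, realize_memFormula, Formula.realize_sup, Formula.realize_equal,
    Term.realize_var, Sum.elim_inl, Sum.elim_inr]
  constructor
  · intro h
    ext w
    rw [ZFSet.mem_pair]
    constructor
    · intro hw
      simpa only [Subtype.ext_iff] using (h fun _ => ⟨w, HSet_mem_of_mem (v z).2 hw⟩).1 hw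
    · rintro (rfl | rfl)
      · exact (h fun _ => v x).2 (Or.inl rfl)
      · exact (h fun _ => v y).2 (Or.inr rfl)
  · intro h a
    simp only [h, ZFSet.mem_pair, Subtype.ext_iff]

/-- The formula `z = (x, y)`. -/
noncomputable def pairFormula (z x y : α) : setLanguage.Formula α :=
  Formula.iExs Bool (unorderedFormula (Sum.inr true) (Sum.inl x) (Sum.inl x) ⊓
    (unorderedFormula (Sum.inr false) (Sum.inl x) (Sum.inl y) ⊓
      unorderedFormula (Sum.inl z) (Sum.inr true) (Sum.inr false)))

theorem realize_pairFormula {z x y : α} {v : α → HSet κ} :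
    (pairFormula z x y).Realize v ↔ (v z : ZFSet.{u}) = ZFSet.pair (v x) (v y) := by
  rw [pairFormula, Formula.realize_iExs]
  simp only [Formula.realize_inf, realize_unorderedFormula, Sum.elim_inl, Sum.elim_inr, ZFSet.pair]
  constructor
  · rintro ⟨i, h1, h2, h3⟩
    rw [h3, h1, h2]
    congr 1
    ext; simp
  · intro h
    have h1 : ({(v x : ZFSet.{u})} : ZFSet.{u}) ∈ (v z : ZFSet.{u}) := by simp [h]
    have h2 : ({(v x : ZFSet.{u}), (v y : ZFSet.{u})} : ZFSet.{u}) ∈ (v z : ZFSet.{u}) := by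
      simp [h]
    refine ⟨fun b => if b then ⟨_, HSet_mem_of_mem (v z).2 h1⟩ else ⟨_, HSet_mem_of_mem (v z).2 h2⟩,
      ?_, rfl, h⟩
    ext; simp

/-- The formula `((x, y), z) ∈ g`. -/
noncomputable def graphFormula (g x y z : α) : setLanguage.Formula α :=
  Formula.iExs Bool (pairFormula (Sum.inr true) (Sum.inl x) (Sum.inl y) ⊓
    (pairFormula (Sum.inr false) (Sum.inr true) (Sum.inl z) ⊓
      memFormula (Sum.inr false) (Sum.inl g)))

theorem realize_graphFormula {g x y z : α} {v : α → HSet κ} :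
    (graphFormula g x y z).Realize v ↔
      ZFSet.pair (ZFSet.pair (v x) (v y)) (v z) ∈ (v g : ZFSet.{u}) := by
  rw [graphFormula, Formula.realize_iExs]
  simp only [Formula.realize_inf, realize_pairFormula, realize_memFormula, Sum.elim_inl,
    Sum.elim_inr]
  constructor
  · rintro ⟨i, h1, h2, h3⟩
    rwa [h2, h1] at h3
  · intro h
    have h1 := HSet_mem_of_mem (v g).2 h
    have h2 : ({ZFSet.pair (v x) (v y)} : ZFSet.{u}) ∈ HSet κ :=
      HSet_mem_of_mem h1 (by simp [ZFSet.pair])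
    have h3 := HSet_mem_of_mem h2 (ZFSet.mem_singleton.2 rfl)
    exact ⟨fun b => if b then ⟨_, h3⟩ else ⟨_, h1⟩, rfl, rfl, h⟩

end SetFormulas

/-! ### Elementary submodels of `H(κ)` and their isomorphisms. -/

section Submodels

open FirstOrder FirstOrder.Language

variable {κ : Cardinal.{u}} {N N' : setLanguage.ElementarySubstructure (HSet κ)}

theorem realize_coe_iff {α : Type} (φ : setLanguage.Formula α) (v : α → N) :
    φ.Realize (fun a => (v a : HSet κ)) ↔ φ.Realize v :=
  N.subtype.map_formula φ v

/-- Elementarity for an existential formula with one quantifier. -/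
theorem exists_elems_of_exists {α : Type} (φ : setLanguage.Formula (α ⊕ Unit)) (v : α → N)
    (h : ∃ b : HSet κ, φ.Realize (Sum.elim (fun a => (v a : HSet κ)) fun _ => b)) :
    ∃ b : N, φ.Realize (Sum.elim (fun a => (v a : HSet κ)) fun _ => (b : HSet κ)) := by
  obtain ⟨b, hb⟩ := h
  have h1 : (φ.iExs Unit).Realize fun a => (v a : HSet κ) :=
    (Formula.realize_iExs).2 ⟨fun _ => b, hb⟩
  rw [realize_coe_iff, Formula.realize_iExs] at h1
  obtain ⟨i, hi⟩ := h1
  refine ⟨i (), ?_⟩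
  rw [← realize_coe_iff] at hi
  convert hi using 1
  funext a
  rcases a with a | a <;> rfl

/-- Elementarity yields some value inside the submodel, and uniqueness identifies it with `z`. This
is how submodels are closed under functions that belong to them. -/
theorem mem_elems_of_graph {g x y z : ZFSet.{u}} (hg : g ∈ elems N) (hx : x ∈ elems N)
    (hy : y ∈ elems N) (h : ZFSet.pair (ZFSet.pair x y) z ∈ g)
    (huniq : ∀ z', ZFSet.pair (ZFSet.pair x y) z' ∈ g → z' = z) : z ∈ elems N := by
  obtain ⟨g, rfl⟩ := hg
  obtain ⟨x, rfl⟩ := hx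
  obtain ⟨y, rfl⟩ := hy
  have hz : z ∈ HSet κ := HSet_mem_of_mem
    (HSet_mem_of_mem (HSet_mem_of_mem (g : HSet κ).2 h) (x := {ZFSet.pair x y, z})
      (by simp [ZFSet.pair])) (by simp)
  obtain ⟨b, hb⟩ := exists_elems_of_exists (N := N)
    (graphFormula (Sum.inl 0) (Sum.inl 1) (Sum.inl 2) (Sum.inr ())) ![g, x, y]
    ⟨⟨z, hz⟩, by
      rw [realize_graphFormula]
      simpa only [Sum.elim_inl, Sum.elim_inr, Matrix.cons_val] using h⟩
  rw [realize_graphFormula] at hb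
  simp only [Sum.elim_inl, Sum.elim_inr, Matrix.cons_val] at hb
  exact ⟨b, huniq _ hb⟩

theorem fst_mem_elems {x y : ZFSet.{u}} (h : ZFSet.pair x y ∈ elems N) : x ∈ elems N := by
  obtain ⟨z, hz⟩ := h
  have hm : ({x} : ZFSet.{u}) ∈ ((z : HSet κ) : ZFSet.{u}) := by simp [hz, ZFSet.pair]
  have hm2 : ({x, y} : ZFSet.{u}) ∈ ((z : HSet κ) : ZFSet.{u}) := by simp [hz, ZFSet.pair]
  have hx : x ∈ HSet κ := HSet_mem_of_mem (HSet_mem_of_mem (z : HSet κ).2 hm) (by simp)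
  have hy : y ∈ HSet κ := HSet_mem_of_mem (HSet_mem_of_mem (z : HSet κ).2 hm2) (by simp)
  obtain ⟨b, hb⟩ := exists_elems_of_exists (N := N)
    (Formula.iExs Unit (pairFormula (Sum.inl (Sum.inl ())) (Sum.inl (Sum.inr ())) (Sum.inr ())))
    (fun _ => z)
    ⟨⟨x, hx⟩, Formula.realize_iExs.2 ⟨fun _ => ⟨y, hy⟩, realize_pairFormula.2 hz⟩⟩
  rw [Formula.realize_iExs] at hb
  obtain ⟨i, hi⟩ := hb
  have := realize_pairFormula.1 hi
  simp only [Sum.elim_inl, Sum.elim_inr] at this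
  rw [hz, ZFSet.pair_inj] at this
  exact ⟨b, this.1.symm⟩

theorem snd_mem_elems {x y : ZFSet.{u}} (h : ZFSet.pair x y ∈ elems N) : y ∈ elems N := by
  have hx := fst_mem_elems h
  obtain ⟨z, hz⟩ := h
  obtain ⟨a, rfl⟩ := hx
  have hm2 : ({↑↑a, y} : ZFSet.{u}) ∈ ((z : HSet κ) : ZFSet.{u}) := by simp [hz, ZFSet.pair]
  have hy : y ∈ HSet κ := HSet_mem_of_mem (HSet_mem_of_mem (z : HSet κ).2 hm2) (by simp)
  obtain ⟨b, hb⟩ := exists_elems_of_exists (N := N)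
    (pairFormula (Sum.inl 0) (Sum.inl 1) (Sum.inr ())) ![z, a]
    ⟨⟨y, hy⟩, by
      rw [realize_pairFormula]
      simpa only [Sum.elim_inl, Sum.elim_inr, Matrix.cons_val] using hz⟩
  rw [realize_pairFormula] at hb
  simp only [Sum.elim_inl, Sum.elim_inr, Matrix.cons_val] at hb
  rw [hz, ZFSet.pair_inj] at hb
  exact ⟨b, hb.2.symm⟩

/-- A set that codes a finite list of sets. -/
def tupleSet (l : List ZFSet.{u}) : ZFSet.{u} := l.foldr ZFSet.pair ∅

theorem mem_elems_of_tupleSet {l : List ZFSet.{u}} (h : tupleSet l ∈ elems N) :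
    ∀ g ∈ l, g ∈ elems N := by
  induction l with
  | nil => simp
  | cons a l ih =>
    intro g hg
    rcases List.mem_cons.1 hg with rfl | hg
    · exact fst_mem_elems h
    · exact ih (snd_mem_elems h) g hg

theorem IsoSends.graph {h : N ≃[setLanguage] N'} {g g' x x' y y' z z' : ZFSet.{u}}
    (hg : IsoSends h g g') (hx : IsoSends h x x') (hy : IsoSends h y y') (hz : IsoSends h z z')
    (hxyz : ZFSet.pair (ZFSet.pair x y) z ∈ g) : ZFSet.pair (ZFSet.pair x' y') z' ∈ g' := by
  obtain ⟨g, rfl, rfl⟩ := hg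
  obtain ⟨x, rfl, rfl⟩ := hx
  obtain ⟨y, rfl, rfl⟩ := hy
  obtain ⟨z, rfl, rfl⟩ := hz
  have h1 : (graphFormula 0 1 2 3).Realize fun a => ((![g, x, y, z] a : N) : HSet κ) := by
    rw [realize_graphFormula]
    simpa only [Matrix.cons_val] using hxyz
  rw [realize_coe_iff, ← StrongHomClass.realize_formula h, ← realize_coe_iff,
    realize_graphFormula] at h1
  simpa only [Matrix.cons_val, Function.comp_apply] using h1

theorem IsoSends.unique {h : N ≃[setLanguage] N'} {x y z : ZFSet.{u}}
    (hy : IsoSends h x y) (hz : IsoSends h x z) : y = z := by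
  obtain ⟨a, rfl, rfl⟩ := hy
  obtain ⟨b, hb, rfl⟩ := hz
  obtain rfl : b = a := Subtype.ext (Subtype.ext hb)
  rfl

theorem exists_isoSends (h : N ≃[setLanguage] N') {x : ZFSet.{u}} (hx : x ∈ elems N) :
    ∃ y, IsoSends h x y := by
  obtain ⟨a, rfl⟩ := hx
  exact ⟨_, a, rfl, rfl⟩

theorem exists_isoSends_of_mem (h : N ≃[setLanguage] N') {y : ZFSet.{u}} (hy : y ∈ elems N') :
    ∃ x, IsoSends h x y := by
  obtain ⟨a, rfl⟩ := hy
  exact ⟨_, h.symm a, rfl, by simp⟩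

theorem IsoSends.left_mem {h : N ≃[setLanguage] N'} {x y : ZFSet.{u}} (hxy : IsoSends h x y) :
    x ∈ elems N := hxy.imp fun _ ha => ha.1

theorem IsoSends.right_mem {h : N ≃[setLanguage] N'} {x y : ZFSet.{u}} (hxy : IsoSends h x y) :
    y ∈ elems N' := by
  obtain ⟨a, -, ha⟩ := hxy
  exact ⟨h a, ha⟩

end Submodels

/-! ### From submodels to sets of codes closed under binary operations. -/

section Hulls

open FirstOrder FirstOrder.Language

/-- `h` maps `M` onto `M'`, respects the operations `ops`, under which `M` is closed, and fixes the
common elements of `M` and `M'`. -/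
structure IsHullIso {W : Type u} (ops : List (W → W → W)) (M M' : Set W) (h : W → W) : Prop where
  countable : M.Countable
  op_mem : ∀ F ∈ ops, ∀ a ∈ M, ∀ b ∈ M, F a b ∈ M
  map_op : ∀ F ∈ ops, ∀ a ∈ M, ∀ b ∈ M, h (F a b) = F (h a) (h b)
  image_eq : h '' M = M'
  fix : ∀ a ∈ M, a ∈ M' → h a = a

theorem IsHullIso.mapsTo {W : Type u} {ops : List (W → W → W)} {M M' : Set W} {h : W → W}
    (H : IsHullIso ops M M' h) {a : W} (ha : a ∈ M) : h a ∈ M' :=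
  H.image_eq ▸ Set.mem_image_of_mem h ha

theorem IsHullIso.op_mem' {W : Type u} {ops : List (W → W → W)} {M M' : Set W} {h : W → W}
    (H : IsHullIso ops M M' h) : ∀ F ∈ ops, ∀ a ∈ M', ∀ b ∈ M', F a b ∈ M' := by
  intro F hF a ha b hb
  rw [← H.image_eq] at ha hb
  obtain ⟨a, ha, rfl⟩ := ha
  obtain ⟨b, hb, rfl⟩ := hb
  rw [← H.map_op F hF a ha b hb]
  exact H.mapsTo (H.op_mem F hF a ha b hb)

theorem IsHullIso.countable' {W : Type u} {ops : List (W → W → W)} {M M' : Set W} {h : W → W}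
    (H : IsHullIso ops M M' h) : M'.Countable :=
  H.image_eq ▸ H.countable.image h

/-- The graph of a binary operation, transported along a coding. -/
noncomputable def graphSet {W : Type u} (e : W → ZFSet.{u}) (F : W → W → W) : ZFSet.{u} :=
  ZFSet.range fun p : W × W => ZFSet.pair (ZFSet.pair (e p.1) (e p.2)) (e (F p.1 p.2))

/-- The translation of one coding into another one. -/
noncomputable def bridgeSet {A : Type u} (c d : A → ZFSet.{u}) : ZFSet.{u} :=
  ZFSet.range fun a : A => ZFSet.pair (ZFSet.pair (c a) (c a)) (d a)

variable {κ : Cardinal.{u}} {N N' : setLanguage.ElementarySubstructure (HSet κ)}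

theorem mem_elems_of_bridge {A : Type u} {c d : A → ZFSet.{u}} (hc : Function.Injective c)
    (hN : bridgeSet c d ∈ elems N) {a : A} (ha : c a ∈ elems N) : d a ∈ elems N := by
  refine mem_elems_of_graph hN ha ha (ZFSet.mem_range.2 ⟨a, rfl⟩) fun z' hz' => ?_
  obtain ⟨b, hb⟩ := ZFSet.mem_range.1 hz'
  simp only [ZFSet.pair_inj] at hb
  rw [← hb.2, hc hb.1.1]

theorem isoSends_bridge {h : N ≃[setLanguage] N'} {A : Type u} {c d : A → ZFSet.{u}}
    (hc : Function.Injective c) (hN : IsoSends h (bridgeSet c d) (bridgeSet c d)) {a a' : A}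
    (ha : IsoSends h (c a) (c a')) : IsoSends h (d a) (d a') := by
  obtain ⟨y, hy⟩ := exists_isoSends h (mem_elems_of_bridge hc hN.left_mem ha.left_mem)
  have := hN.graph ha ha hy (ZFSet.mem_range.2 ⟨a, rfl⟩)
  obtain ⟨b, hb⟩ := ZFSet.mem_range.1 this
  simp only [ZFSet.pair_inj] at hb
  rwa [← hb.2, hc hb.1.1] at hy

theorem op_mem_elems {W : Type u} {e : W → ZFSet.{u}} (he : Function.Injective e)
    {F : W → W → W} (hF : graphSet e F ∈ elems N) {a b : W} (ha : e a ∈ elems N)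
    (hb : e b ∈ elems N) : e (F a b) ∈ elems N := by
  refine mem_elems_of_graph hF ha hb (ZFSet.mem_range.2 ⟨(a, b), rfl⟩) fun z' hz' => ?_
  obtain ⟨⟨a', b'⟩, hb⟩ := ZFSet.mem_range.1 hz'
  simp only [ZFSet.pair_inj] at hb
  rw [← hb.2, he hb.1.1, he hb.1.2]

theorem isoSends_op {h : N ≃[setLanguage] N'} {W : Type u} {e : W → ZFSet.{u}}
    (he : Function.Injective e) {F : W → W → W}
    (hF : IsoSends h (graphSet e F) (graphSet e F)) {a b a' b' : W}
    (ha : IsoSends h (e a) (e a')) (hb : IsoSends h (e b) (e b')) :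
    IsoSends h (e (F a b)) (e (F a' b')) := by
  obtain ⟨y, hy⟩ := exists_isoSends h (op_mem_elems he hF.left_mem ha.left_mem hb.left_mem)
  have := hF.graph ha hb hy (ZFSet.mem_range.2 ⟨(a, b), rfl⟩)
  obtain ⟨⟨a'', b''⟩, hb⟩ := ZFSet.mem_range.1 this
  simp only [ZFSet.pair_inj] at hb
  rwa [← hb.2, he hb.1.1, he hb.1.2] at hy

/-- The graph of the first projection serves as a predicate for being a code: every triple in it
consists of codes, and the isomorphism preserves membership in it. -/
theorem exists_isoSends_code {h : N ≃[setLanguage] N'} {W : Type u} {e : W → ZFSet.{u}}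
    (hF : IsoSends h (graphSet e fun a _ => a) (graphSet e fun a _ => a)) {a : W}
    (ha : e a ∈ elems N) : ∃ b, IsoSends h (e a) (e b) := by
  obtain ⟨y, hy⟩ := exists_isoSends h ha
  obtain ⟨⟨b, b'⟩, hb⟩ := ZFSet.mem_range.1 (hF.graph hy hy hy (ZFSet.mem_range.2 ⟨(a, a), rfl⟩))
  simp only [ZFSet.pair_inj] at hb
  exact ⟨b, hb.2 ▸ hy⟩

theorem exists_code_isoSends {h : N ≃[setLanguage] N'} {W : Type u} {e : W → ZFSet.{u}}
    (hF : IsoSends h (graphSet e fun a _ => a) (graphSet e fun a _ => a)) {b : W}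
    (hb : e b ∈ elems N') : ∃ a, IsoSends h (e a) (e b) := by
  obtain ⟨x, hx⟩ := exists_isoSends_of_mem h hb
  obtain ⟨g, hg, hg'⟩ := hF
  obtain ⟨x, rfl, hx'⟩ := hx
  have hF' : IsoSends h.symm (graphSet e fun a _ => a) (graphSet e fun a _ => a) :=
    ⟨h g, hg', by simpa using hg⟩
  have hx : IsoSends h.symm (e b) ((x : HSet κ) : ZFSet.{u}) := ⟨h x, hx', by simp⟩
  obtain ⟨⟨a, a'⟩, ha⟩ := ZFSet.mem_range.1 (hF'.graph hx hx hx (ZFSet.mem_range.2 ⟨(b, b), rfl⟩))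
  simp only [ZFSet.pair_inj] at ha
  exact ⟨a, x, ha.2.symm, hx'⟩

/-- After this reduction the combinatorial argument needs no logic: it uses only closure under the
operations, commutation with them and the fixing of common elements. -/
theorem exists_isHullIso {h : N ≃[setLanguage] N'} {W : Type u} {e : W → ZFSet.{u}}
    (he : Function.Injective e) {ops : List (W → W → W)} (hid : (fun a _ => a) ∈ ops)
    (hops : ∀ F ∈ ops, IsoSends h (graphSet e F) (graphSet e F)) (hN : (elems N).Countable)
    (hfix : ∀ z, z ∈ elems N → z ∈ elems N' → IsoSends h z z) :
    ∃ g : W → W, IsHullIso ops {w | e w ∈ elems N} {w | e w ∈ elems N'} g ∧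
      ∀ w w', IsoSends h (e w) (e w') → g w = w' := by
  classical
  have key : ∀ w, ∃ w', e w ∈ elems N → IsoSends h (e w) (e w') := by
    intro w
    by_cases hw : e w ∈ elems N
    · obtain ⟨b, hb⟩ := exists_isoSends_code (hops _ hid) hw
      exact ⟨b, fun _ => hb⟩
    · exact ⟨w, fun h => absurd h hw⟩
  choose g hg using key
  have hgu : ∀ w w', IsoSends h (e w) (e w') → g w = w' := fun w w' hw =>
    he ((hg w hw.left_mem).unique hw)
  refine ⟨g, ⟨hN.preimage he, fun F hF a ha b hb => op_mem_elems he (hops F hF).left_mem ha hb,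
    fun F hF a ha b hb => hgu _ _ (isoSends_op he (hops F hF) (hg a ha) (hg b hb)), ?_,
    fun a ha ha' => hgu _ _ (hfix _ ha ha')⟩, hgu⟩
  ext w'
  constructor
  · rintro ⟨w, hw, rfl⟩
    exact (hg w hw).right_mem
  · intro hw'
    obtain ⟨w, hw⟩ := exists_code_isoSends (hops _ hid) hw'
    exact ⟨w, hw.left_mem, hgu _ _ hw⟩

end Hulls

open Filter Topology

/-! ### Countable sets of countable ordinals are bounded. -/

section OmegaOneFacts

theorem countable_Iic_omegaOne (α : OmegaOne.{u}) : (Set.Iic α).Countable := by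
  have h : (Set.Iio α).Countable := by
    rw [← Cardinal.le_aleph0_iff_set_countable, ← Order.lt_succ_iff, Cardinal.succ_aleph0]
    have hα := Cardinal.mk_Iio_lt α (by simp)
    rwa [Cardinal.mk_toType, Ordinal.card_omega] at hα
  rw [← Set.Iio_insert]
  exact h.insert α

theorem not_countable_omegaOne : ¬ (Set.univ : Set OmegaOne.{u}).Countable := by
  rw [← Cardinal.le_aleph0_iff_set_countable, Cardinal.mk_univ, Cardinal.mk_toType,
    Ordinal.card_omega, not_le]
  exact Cardinal.aleph0_lt_aleph_one

theorem exists_lt_omegaOne_of_countable {S : Set OmegaOne.{u}} (hS : S.Countable) :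
    ∃ γ, ∀ β, γ < β → β ∉ S := by
  by_contra! h
  refine not_countable_omegaOne ((hS.biUnion fun β _ => countable_Iic_omegaOne β).mono ?_)
  intro γ _
  obtain ⟨β, h1, h2⟩ := h γ
  exact Set.mem_biUnion h2 h1.le

instance : NoMaxOrder OmegaOne.{u} where
  exists_gt α := by
    by_contra! h
    exact not_countable_omegaOne ((countable_Iic_omegaOne α).mono fun β _ => h β)

instance : Nonempty OmegaOne.{u} := by
  by_contra h
  rw [not_nonempty_iff] at h
  exact not_countable_omegaOne (Set.countable_univ_iff.2 inferInstance)

end OmegaOneFacts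

/-! ### Maximal filters of closed sets. -/

section ClosedFilters

variable {X : Type u} [TopologicalSpace X] {F : Set (Set X)}

/-- If `E` met every member of `F`, the closed supersets of the traces `A ∩ E` would form a proper
filter extending `F` and containing `E`. -/
theorem IsMaximalClosedFilter.exists_disjoint (hF : IsMaximalClosedFilter F) {E : Set X}
    (hE : IsClosed E) (hEF : E ∉ F) : ∃ A ∈ F, A ∩ E = ∅ := by
  by_contra! h
  apply hEF
  refine hF.2 {B | IsClosed B ∧ ∃ A ∈ F, A ∩ E ⊆ B} ⟨fun A hA => hA.1, ?_, ?_, ?_, ?_⟩ ?_ ?_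
  · exact ⟨isClosed_univ, _, hF.1.univ_mem, Set.subset_univ _⟩
  · rintro ⟨-, A, hA, hA'⟩
    exact (h A hA).ne_empty (Set.subset_empty_iff.1 hA')
  · rintro A ⟨hA, A', hA', hAA'⟩ B ⟨hB, B', hB', hBB'⟩
    exact ⟨hA.inter hB, _, hF.1.inter_mem _ hA' _ hB', fun x hx =>
      ⟨hAA' ⟨hx.1.1, hx.2⟩, hBB' ⟨hx.1.2, hx.2⟩⟩⟩
  · rintro A ⟨hA, A', hA', hAA'⟩ B hB hAB
    exact ⟨hB, A', hA', hAA'.trans hAB⟩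
  · exact fun A hA => ⟨hF.1.isClosed A hA, A, hA, Set.inter_subset_left⟩
  · exact ⟨hE, _, hF.1.univ_mem, Set.inter_subset_right⟩

theorem IsMaximalClosedFilter.union_notMem (hF : IsMaximalClosedFilter F) {S T : Set X}
    (hS : closure S ∉ F) (hT : closure T ∉ F) : closure (S ∪ T) ∉ F := by
  intro h
  obtain ⟨A, hA, hAS⟩ := hF.exists_disjoint isClosed_closure hS
  obtain ⟨B, hB, hBT⟩ := hF.exists_disjoint isClosed_closure hT
  refine hF.1.empty_notMem ?_
  convert hF.1.inter_mem _ (hF.1.inter_mem _ hA _ hB) _ h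
  rw [closure_union, Set.inter_union_distrib_left, eq_comm, Set.union_empty_iff]
  constructor
  · exact Set.subset_empty_iff.1 fun x hx => hAS.subset ⟨hx.1.1, hx.2⟩
  · exact Set.subset_empty_iff.1 fun x hx => hBT.subset ⟨hx.1.2, hx.2⟩

theorem IsClosedFilter.notMem_mono (hF : IsClosedFilter F) {S T : Set X} (hST : S ⊆ T)
    (hT : closure T ∉ F) : closure S ∉ F := fun h =>
  hT (hF.mem_of_superset _ h _ isClosed_closure (closure_mono hST))

/-- Some member of `F` misses `x`, and regularity separates it from a closed neighbourhood of `x`.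
In the fusion this keeps the closure of the new points, which gather near the limit, out of the
filter. -/
theorem IsClosedFilter.exists_nhds_notMem [RegularSpace X] (hF : IsClosedFilter F)
    (hfix : ⋂₀ F = ∅) (x : X) : ∃ U ∈ 𝓝 x, closure U ∉ F := by
  have hx : x ∉ ⋂₀ F := by simp [hfix]
  rw [Set.mem_sInter] at hx
  push Not at hx
  obtain ⟨A, hA, hxA⟩ := hx
  obtain ⟨U, hU, hUc, hUA⟩ := exists_mem_nhds_isClosed_subset
    ((hF.isClosed A hA).isOpen_compl.mem_nhds hxA)
  refine ⟨U, hU, fun h => hF.empty_notMem ?_⟩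
  convert hF.inter_mem _ h _ hA
  rw [hUc.closure_eq, eq_comm, ← Set.disjoint_iff_inter_eq_empty]
  exact Set.subset_compl_iff_disjoint_right.1 hUA

theorem SpaceChoice.exists_forall_pt_mem (C : SpaceChoice X) {A : Set X} (hA : A ∈ C.filt) :
    ∃ γ, ∀ β, γ < β → C.pt β ∈ A := by
  obtain ⟨γ, hγ⟩ := exists_lt_omegaOne_of_countable (S := C.pt ⁻¹' (Set.range C.pt \ A))
    ((C.diagonalizes.2 A hA).preimage C.pt_injective)
  refine ⟨γ, fun β hβ => ?_⟩
  by_contra h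
  exact hγ β hβ ⟨⟨β, rfl⟩, h⟩

end ClosedFilters

/-! ### Diagonal subsequences. -/

section Sequences

/-- A diagonal argument: countably many sequences in sequentially compact spaces converge along a
common subsequence. -/
theorem exists_strictMono_forall_tendsto {ι : Type u} {X : ι → Type u}
    [∀ ξ, TopologicalSpace (X ξ)] [∀ ξ, SeqCompactSpace (X ξ)] [∀ ξ, Nonempty (X ξ)] {J : Set ι}
    (hJ : J.Countable) (s : ∀ ξ, ℕ → X ξ) :
    ∃ (φ : ℕ → ℕ) (x : ∀ ξ, X ξ), StrictMono φ ∧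
      ∀ ξ ∈ J, Tendsto (fun n => s ξ (φ n)) atTop (𝓝 (x ξ)) := by
  classical
  rcases J.eq_empty_or_nonempty with rfl | hne
  · exact ⟨id, fun ξ => Classical.arbitrary _, strictMono_id, by simp⟩
  obtain ⟨j, rfl⟩ := hJ.exists_eq_range hne
  have hsub : ∀ (ξ : ι) (ψ : ℕ → ℕ), ∃ (a : X ξ) (θ : ℕ → ℕ), StrictMono θ ∧
      Tendsto (fun n => s ξ (ψ (θ n))) atTop (𝓝 a) := fun ξ ψ =>
    SeqCompactSpace.tendsto_subseq fun n => s ξ (ψ n)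
  choose a θ hθ ha using hsub
  let ψ : ℕ → ℕ → ℕ := fun m => Nat.rec id (fun m ψ => ψ ∘ θ (j m) ψ) m
  have hψs : ∀ m, ψ (m + 1) = ψ m ∘ θ (j m) (ψ m) := fun m => rfl
  have hψ : ∀ m, StrictMono (ψ m) := by
    intro m
    induction m with
    | zero => exact strictMono_id
    | succ m ih => exact ih.comp (hθ _ _)
  -- Later subsequences factor through earlier ones by maps `ρ ≥ id`, so from some index on the
  -- diagonal runs through `ψ (m + 1)` along indices tending to infinity.
  have hfac : ∀ m l, ∃ ρ : ℕ → ℕ, (∀ n, n ≤ ρ n) ∧ ψ (m + l) = ψ m ∘ ρ := by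
    intro m l
    induction l with
    | zero => exact ⟨id, fun n => le_rfl, rfl⟩
    | succ l ih =>
      obtain ⟨ρ, hρ, h⟩ := ih
      refine ⟨ρ ∘ θ (j (m + l)) (ψ (m + l)), fun n => ((hθ _ _).le_apply).trans (hρ _), ?_⟩
      rw [← add_assoc, hψs, h]
      rfl
  have hlim : ∀ m, Tendsto (fun n => s (j m) (ψ n n)) atTop (𝓝 (a (j m) (ψ m))) := by
    intro m
    have hρ : ∀ n, ∃ k, m + 1 ≤ n → n ≤ k ∧ ψ n n = ψ (m + 1) k := by
      intro n
      by_cases h : m + 1 ≤ n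
      · obtain ⟨l, rfl⟩ := Nat.exists_eq_add_of_le h
        obtain ⟨ρ, h1, h2⟩ := hfac (m + 1) l
        exact ⟨ρ (m + 1 + l), fun _ => ⟨h1 _, congrFun h2 _⟩⟩
      · exact ⟨0, fun h' => absurd h' h⟩
    choose ρ hρ using hρ
    have hρt : Tendsto ρ atTop atTop := by
      refine tendsto_atTop_mono' atTop ?_ tendsto_id
      filter_upwards [eventually_ge_atTop (m + 1)] with n hn using (hρ n hn).1
    refine ((ha (j m) (ψ m)).comp hρt).congr' ?_
    filter_upwards [eventually_ge_atTop (m + 1)] with n hn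
    simp only [Function.comp_apply]
    rw [(hρ n hn).2, hψs]
    rfl
  have hx : ∀ ξ, ∃ x : X ξ, ξ ∈ Set.range j → Tendsto (fun n => s ξ (ψ n n)) atTop (𝓝 x) := by
    intro ξ
    by_cases h : ξ ∈ Set.range j
    · obtain ⟨m, rfl⟩ := h
      exact ⟨_, fun _ => hlim m⟩
    · exact ⟨Classical.arbitrary _, fun h' => absurd h' h⟩
  choose x hx using hx
  refine ⟨fun n => ψ n n, x, strictMono_nat_of_lt_succ fun n => ?_, hx⟩
  rw [hψs]
  exact hψ n (n.lt_succ_self.trans_le (hθ _ _).le_apply)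

end Sequences

/-! ### Safety and limits of points far along the enumerations. -/

section Bans

variable {ι : Type u} {X : ι → Type u} [∀ ξ, TopologicalSpace (X ξ)] {C : ∀ ξ, SpaceChoice (X ξ)}

/-- Limits of points far enough along the enumerations are not banned. -/
theorem IsSafe.exists_bound (hC : IsSafe C) (v : Finset ι) {f : OmegaOne.{u} → Option ℕ}
    (hf : IsPromise f) : ∃ γ, ∀ (s : ℕ → OmegaOne.{u}) (x : ∀ ξ, X ξ),
      (∀ ξ ∈ v, Tendsto (fun n => (C ξ).pt (s n)) atTop (𝓝 (x ξ))) → (∀ᶠ n in atTop, γ < s n) →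
      ¬ {α | ∃ n, f α = some n ∧ ∀ ξ ∈ v, x ξ ∈ (C ξ).base α n}.Countable := by
  have h := hC v
  rw [IsDangerous] at h
  push Not at h
  have h := h f hf
  rw [IsLarge] at h
  push Not at h
  -- Safety provides a box `∏ A_ξ` of filter members without banned points. The tails of the
  -- enumerations lie in the closed sets `A_ξ`, hence so do their limits.
  obtain ⟨E, ⟨-, A, hA, hAE⟩, hE⟩ := h
  choose γ hγ using fun ξ : v => (C ξ).exists_forall_pt_mem (hA ξ)
  obtain ⟨δ, hδ⟩ := exists_lt_omegaOne_of_countable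
    (Set.countable_iUnion fun ξ : v => countable_Iic_omegaOne (γ ξ))
  refine ⟨δ, fun s x hx hs hcount => ?_⟩
  have hmem : (fun ξ : v => x ξ) ∈ banned C v f ∩ E := by
    refine ⟨?_, hAE fun ξ _ => ?_⟩
    · simpa only [banned, Set.mem_ofPred_eq, Subtype.forall] using hcount
    · refine ((C ξ).filt_maximal.1.isClosed _ (hA ξ)).mem_of_tendsto (hx ξ ξ.2) ?_
      filter_upwards [hs] with n hn
      refine hγ ξ _ (lt_of_not_ge fun hle => hδ _ hn ?_)
      exact Set.mem_iUnion.2 ⟨ξ, hle⟩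
  rw [hE] at hmem
  exact hmem

/-- As `v` is finite, each `α` whose neighbourhoods contain the limit is witnessed by all large `k`.
If the witnessed sets were countable for arbitrarily large `k`, their union would exhaust an
uncountable set. -/
theorem exists_basis_subset_uncountable {x : ∀ ξ, X ξ} {U : ∀ ξ, ℕ → Set (X ξ)} {v : Finset ι}
    (hU : ∀ ξ ∈ v, (𝓝 (x ξ)).HasAntitoneBasis (U ξ)) {f : OmegaOne.{u} → Option ℕ}
    (hf : ¬ {α | ∃ n, f α = some n ∧ ∀ ξ ∈ v, x ξ ∈ (C ξ).base α n}.Countable) :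
    ∃ k₀, ∀ k, k₀ ≤ k →
      ¬ {α | ∃ n, f α = some n ∧ ∀ ξ ∈ v, U ξ k ⊆ (C ξ).base α n}.Countable := by
  by_contra! h
  choose k hk hkc using h
  refine hf ((Set.countable_iUnion fun n => hkc n).mono ?_)
  rintro α ⟨n, hn, hα⟩
  have : ∀ᶠ i in atTop, ∀ ξ ∈ v, U ξ i ⊆ (C ξ).base α n := by
    rw [Filter.eventually_all_finset]
    intro ξ hξ
    obtain ⟨i, hi⟩ := (hU ξ hξ).mem_iff.1 (((C ξ).base_isOpen α n).mem_nhds (hα ξ hξ))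
    filter_upwards [eventually_ge_atTop i] with i' hi' using ((hU ξ hξ).antitone hi').trans hi
  obtain ⟨i, hi⟩ := this.exists_forall_of_atTop
  exact Set.mem_iUnion.2 ⟨i, n, hn, hi _ (hk i)⟩

end Bans

/-! ### Extending conditions into dense sets near a point. -/

namespace PX

variable {ι : Type u} {X : ι → Type u} [∀ ξ, TopologicalSpace (X ξ)] {C : ∀ ξ, SpaceChoice (X ξ)}

theorem Y_self (v : Finset ι) (f : OmegaOne.{u} → Option ℕ) {q p : PX C} (h : q.a = p.a) :
    Y v f q p = promiseDom f := by
  ext α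
  simp [Y, promiseDom, Option.ne_none_iff_exists', h]

theorem restrictTo_promiseDom (f : OmegaOne.{u} → Option ℕ) :
    restrictTo f (promiseDom f) = f := by
  funext α
  by_cases h : f α = none <;> simp [restrictTo, promiseDom, h]

/-- The condition obtained from `p` by making one more promise. -/
def addPromise (p : PX C) (v : Finset ι) (f : OmegaOne.{u} → Option ℕ) (hf : IsPromise f) :
    PX C where
  a := p.a
  Φ := insert (v, f) p.Φ
  a_countable := p.a_countable
  closure_notMem := p.closure_notMem
  Φ_countable := p.Φ_countable.insert _
  Φ_promise := by
    rintro z (rfl | hz)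
    · exact hf
    · exact p.Φ_promise z hz

theorem addPromise_le (p : PX C) (v : Finset ι) (f : OmegaOne.{u} → Option ℕ)
    (hf : IsPromise f) : p.addPromise v f hf ≤ p := by
  refine ⟨fun _ _ h => h, Set.subset_insert _ _, fun w g hg => ?_⟩
  rw [Y_self w g (q := p.addPromise v f hf) (p := p) rfl, restrictTo_promiseDom]
  exact ⟨p.Φ_promise _ hg, Or.inr hg⟩

/-- A condition can be extended into a dense set by adding points close to any point far enough
along the enumerations. -/
theorem exists_bound_forall_extension (p : PX C) {D : Set (PX C)} (hD : ∀ p, ∃ d ∈ D, d ≤ p)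
    (F : Finset ι) : ∃ γ, ∀ β, γ < β → ∀ n, ∃ r ∈ D, r ≤ p ∧
      ∀ ξ ∈ F, sectionOf r.a ξ \ sectionOf p.a ξ ⊆ (C ξ).base β n := by
  classical
  by_contra! h
  let B : OmegaOne.{u} → ℕ → Prop := fun β n => ∀ r ∈ D, r ≤ p →
    ∃ ξ ∈ F, ¬ sectionOf r.a ξ \ sectionOf p.a ξ ⊆ (C ξ).base β n
  -- The failures themselves form the promise: `f β` is the least `n` for which no extension in `D`
  -- is small at `β`.
  let f : OmegaOne.{u} → Option ℕ := fun β =>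
    if hβ : ∃ n, B β n then some (Nat.find hβ) else none
  have hB : ∀ β n, f β = some n → B β n := by
    intro β n hn
    by_cases hβ : ∃ n, B β n
    · simp only [f, dif_pos hβ, Option.some.injEq] at hn
      exact hn ▸ Nat.find_spec hβ
    · simp [f, dif_neg hβ] at hn
  have hf : IsPromise f := by
    intro hc
    obtain ⟨γ, hγ⟩ := exists_lt_omegaOne_of_countable hc
    obtain ⟨β, hβ, n, hn⟩ := h γ
    refine hγ β hβ ?_
    have hβ : ∃ n, B β n := ⟨n, hn⟩
    simpa [promiseDom, f] using hβ
  obtain ⟨r, hrD, hr⟩ := hD (p.addPromise F f hf)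
  -- An extension in `D` that keeps the promise must be small at some `α` of its domain, which `f α`
  -- excludes.
  obtain ⟨α, n, hn, hα⟩ : (Y F f r (p.addPromise F f hf)).Nonempty := by
    by_contra he
    rw [Set.not_nonempty_iff_eq_empty] at he
    exact (hr.2.2 F f (Or.inl rfl)).1 (he ▸ Set.countable_empty)
  obtain ⟨ξ, hξ, hr'⟩ := hB α n hn r hrD (le_trans hr (addPromise_le _ _ _ _))
  exact hr' (hα ξ hξ)

end PX

/-! ### Fusion of two coherent sequences of conditions. -/

namespace PX

variable {ι : Type u} {X : ι → Type u} [∀ ξ, TopologicalSpace (X ξ)] {C : ∀ ξ, SpaceChoice (X ξ)}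

theorem Y_subset_promiseDom (v : Finset ι) (f : OmegaOne.{u} → Option ℕ) (q p : PX C) :
    Y v f q p ⊆ promiseDom f := by
  rintro α ⟨n, hn, -⟩
  simp [promiseDom, hn]

theorem promiseDom_restrictTo {f : OmegaOne.{u} → Option ℕ} {S : Set OmegaOne.{u}}
    (hS : S ⊆ promiseDom f) : promiseDom (restrictTo f S) = S := by
  ext α
  by_cases hα : α ∈ S
  · simpa [promiseDom, restrictTo, hα] using hS hα
  · simp [promiseDom, restrictTo, hα]

/-- Two decreasing sequences of conditions that agree where they interact, whose new points converge
and which keep all their promises, have a common lower bound. -/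
theorem exists_fusion {p : Bool → ℕ → PX C} (hp : ∀ b n, p b (n + 1) ≤ p b n)
    {I : Bool → Set ι} (hdom : ∀ b n ξ x, (p b n).a ⟨ξ, x⟩ ≠ none → ξ ∈ I b)
    (hcoh : ∀ b n ξ x c, ξ ∈ I b → (p (!b) n).a ⟨ξ, x⟩ = some c → (p b n).a ⟨ξ, x⟩ = some c)
    {U : ∀ ξ, ℕ → Set (X ξ)} (hU : ∀ ξ, Antitone (U ξ))
    (hsmall : ∀ ξ, ∃ k, closure (U ξ k) ∉ (C ξ).filt)
    {k : ℕ → ℕ} (hk : Monotone k) (hk' : ∀ n, n ≤ k n) {F : Bool → ℕ → Finset ι}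
    (hF : ∀ b, ∀ ξ ∈ I b, ∀ᶠ n in atTop, ξ ∈ F b n)
    (hstep : ∀ b n, ∀ ξ ∈ F b n,
      sectionOf (p b (n + 1)).a ξ \ sectionOf (p b n).a ξ ⊆ U ξ (k n))
    (hprom : ∀ b n v f, (v, f) ∈ (p b n).Φ → (∀ ξ ∈ v, ξ ∈ I b) ∧ ∀ᶠ m in atTop,
      ¬ {α | α ∈ Y v f (p b m) (p b n) ∧
        ∃ j, f α = some j ∧ ∀ ξ ∈ v, U ξ (k m) ⊆ (C ξ).base α j}.Countable) :
    ∃ q : PX C, ∀ b n, q ≤ p b n := by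
  classical
  have hanti : ∀ b, Antitone (p b) := fun b => antitone_nat_of_succ_le (hp b)
  have hcons : ∀ z b n c b' n' c', (p b n).a z = some c → (p b' n').a z = some c' → c = c' := by
    rintro ⟨ξ, x⟩ b n c b' n' c' h h'
    have h1 := (hanti b (le_max_left n n')).1 _ _ h
    have h2 := (hanti b' (le_max_right n n')).1 _ _ h'
    rcases eq_or_ne b' b with rfl | hb
    · rw [h1] at h2
      exact Option.some.inj h2
    · obtain rfl : b' = !b := Bool.eq_not.2 hb
      have h3 := hcoh b _ ξ x _ (hdom b n ξ x (by simp [h])) h2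
      rw [h1] at h3
      exact Option.some.inj h3
  let a : (Σ ξ, X ξ) → Option Bool := fun z =>
    if h : ∃ c, ∃ b n, (p b n).a z = some c then some h.choose else none
  have ha : ∀ z c, a z = some c ↔ ∃ b n, (p b n).a z = some c := by
    intro z c
    by_cases h : ∃ c, ∃ b n, (p b n).a z = some c
    · obtain ⟨b, n, hbn⟩ := h.choose_spec
      simp only [a, dif_pos h, Option.some.injEq]
      constructor
      · rintro rfl
        exact ⟨b, n, hbn⟩
      · rintro ⟨b', n', h'⟩
        exact hcons z _ _ _ _ _ _ hbn h'
    · simp only [a, dif_neg h, reduceCtorEq, false_iff]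
      exact fun h' => h ⟨c, h'⟩
  have hsec : ∀ b, ∀ ξ ∈ I b, ∀ x, x ∈ sectionOf a ξ → ∃ n, x ∈ sectionOf (p b n).a ξ := by
    intro b ξ hξ x hx
    obtain ⟨b', n, hn⟩ := (ha _ _).1 hx
    rcases eq_or_ne b' b with rfl | hb
    · exact ⟨n, hn⟩
    · obtain rfl : b' = !b := Bool.eq_not.2 hb
      exact ⟨n, hcoh b n ξ x _ hξ hn⟩
  have hmono : ∀ b m n, m ≤ n → ∀ ξ, sectionOf (p b m).a ξ ⊆ sectionOf (p b n).a ξ :=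
    fun b m n hmn ξ x hx => (hanti b hmn).1 _ _ hx
  -- Every point added after stage `m` lies in `U ξ (k l)` for some `l ≥ m`, hence in `U ξ (k m)`.
  have htail : ∀ b, ∀ ξ ∈ I b, ∀ m, (∀ l, m ≤ l → ξ ∈ F b l) →
      sectionOf a ξ ⊆ sectionOf (p b m).a ξ ∪ U ξ (k m) := by
    intro b ξ hξ m hm x hx
    obtain ⟨n, hn⟩ := hsec b ξ hξ x hx
    have key : ∀ l, sectionOf (p b (m + l)).a ξ ⊆ sectionOf (p b m).a ξ ∪ U ξ (k m) := by
      intro l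
      induction l with
      | zero => exact Set.subset_union_left
      | succ l ih =>
        intro y hy
        by_cases hy' : y ∈ sectionOf (p b (m + l)).a ξ
        · exact ih hy'
        · exact Or.inr (hU ξ (hk (Nat.le_add_right m l))
            (hstep b (m + l) ξ (hm _ (Nat.le_add_right m l)) ⟨hy, hy'⟩))
    exact key n (hmono b n (m + n) (Nat.le_add_left n m) ξ hn)
  have haext : ∀ b n z c, (p b n).a z = some c → a z = some c := fun b n z c h =>
    (ha z c).2 ⟨b, n, h⟩
  have hcount : {z | a z ≠ none}.Countable := by
    refine (Set.countable_iUnion fun b => Set.countable_iUnion fun n =>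
      (p b n).a_countable).mono ?_
    intro z hz
    obtain ⟨c, hc⟩ := Option.ne_none_iff_exists'.1 hz
    obtain ⟨b, n, h⟩ := (ha z c).1 hc
    exact Set.mem_iUnion.2 ⟨b, Set.mem_iUnion.2 ⟨n, by simp [h]⟩⟩
  have hclosure : ∀ ξ, closure (sectionOf a ξ) ∉ (C ξ).filt := by
    intro ξ
    by_cases hξ : ∃ b, ξ ∈ I b
    · obtain ⟨b, hb⟩ := hξ
      obtain ⟨k₀, hk₀⟩ := hsmall ξ
      obtain ⟨m, hm⟩ := eventually_atTop.1 (hF b ξ hb)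
      have hmax := (C ξ).filt_maximal
      refine hmax.1.notMem_mono (htail b ξ hb (max m k₀)
        fun l hl => hm l ((le_max_left _ _).trans hl)) (hmax.union_notMem
          ((p b _).closure_notMem ξ) (hmax.1.notMem_mono (hU ξ ?_) hk₀))
      exact (le_max_right m k₀).trans (hk' _)
    · have : sectionOf a ξ = ∅ := by
        rw [Set.eq_empty_iff_forall_notMem]
        intro x hx
        obtain ⟨b, n, h⟩ := (ha _ _).1 hx
        exact hξ ⟨b, hdom b n ξ x (by simp [h])⟩
      rw [this, closure_empty]
      exact (C ξ).filt_maximal.1.empty_notMem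
  -- `Y` depends only on first coordinates, so this provisional condition suffices to define the
  -- restricted promises that the final one must contain.
  let q₀ : PX C := ⟨a, ∅, hcount, hclosure, Set.countable_empty, by simp⟩
  have hY : ∀ b n v f, (v, f) ∈ (p b n).Φ → ¬ (Y v f q₀ (p b n)).Countable := by
    intro b n v f hf
    obtain ⟨hv, hev⟩ := hprom b n v f hf
    have hvF : ∀ᶠ m in atTop, ∀ ξ ∈ v, ∀ l, m ≤ l → ξ ∈ F b l := by
      rw [Filter.eventually_all_finset]
      intro ξ hξ
      obtain ⟨m, hm⟩ := eventually_atTop.1 (hF b ξ (hv ξ hξ))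
      filter_upwards [eventually_ge_atTop m] with m' hm' l hl using hm l (hm'.trans hl)
    -- One late stage `m` controls everything: points added before it are handled by `Y v f (p b m)
    -- (p b n)`, later ones by `U ξ (k m)`.
    obtain ⟨m, h1, h2⟩ := (hev.and hvF).exists
    refine fun hc => h1 (hc.mono ?_)
    rintro α ⟨⟨j, hj, hαj⟩, j', hj', hα⟩
    obtain rfl : j = j' := by simpa [hj] using hj'
    refine ⟨j, hj, fun ξ hξ x hx => ?_⟩
    rcases htail b ξ (hv ξ hξ) m (h2 ξ hξ) hx.1 with h | h
    · exact hαj ξ hξ ⟨h, hx.2⟩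
    · exact hα ξ hξ h
  let q : PX C := {
    a := a
    Φ := (⋃ b, ⋃ n, (p b n).Φ) ∪
      ⋃ b, ⋃ n, (fun z => (z.1, restrictTo z.2 (Y z.1 z.2 q₀ (p b n)))) '' (p b n).Φ
    a_countable := hcount
    closure_notMem := hclosure
    Φ_countable := (Set.countable_iUnion fun b => Set.countable_iUnion fun n =>
      (p b n).Φ_countable).union (Set.countable_iUnion fun b => Set.countable_iUnion fun n =>
        (p b n).Φ_countable.image _)
    Φ_promise := by
      rintro z (hz | hz)
      · obtain ⟨b, hz⟩ := Set.mem_iUnion.1 hz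
        obtain ⟨n, hz⟩ := Set.mem_iUnion.1 hz
        exact (p b n).Φ_promise z hz
      · obtain ⟨b, hz⟩ := Set.mem_iUnion.1 hz
        obtain ⟨n, y, hy, rfl⟩ := Set.mem_iUnion.1 hz
        rw [IsPromise, promiseDom_restrictTo (Y_subset_promiseDom _ _ _ _)]
        exact hY b n y.1 y.2 hy }
  refine ⟨q, fun b n => ⟨haext b n, ?_, fun v f hf => ⟨hY b n v f hf, ?_⟩⟩⟩
  · exact fun z hz => Or.inl (Set.mem_iUnion.2 ⟨b, Set.mem_iUnion.2 ⟨n, hz⟩⟩)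
  · exact Or.inr (Set.mem_iUnion.2 ⟨b, Set.mem_iUnion.2 ⟨n, (v, f), hf, rfl⟩⟩)

end PX

/-! ### Codes and the operations on them. -/

section Codes

variable {ι : Type u} {X : ι → Type u} [∀ ξ, TopologicalSpace (X ξ)]

/-- The dense subsets of `P(𝒳)`. -/
abbrev DenseSubset (C : ∀ ξ, SpaceChoice (X ξ)) : Type u :=
  {D : Set (PX C) // ∀ p, ∃ d ∈ D, d ≤ p}

/-- The objects that occur in the construction of a generic condition. -/
inductive Code (C : ∀ ξ, SpaceChoice (X ξ)) : Type u
  | nat (n : ℕ)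
  | ord (α : OmegaOne.{u})
  | idx (ξ : ι)
  | pnt (z : Σ ξ, X ξ)
  | condition (p : PX C)
  | dense (D : DenseSubset C)
  | fin (F : Finset ι)
  | prom (v : Finset ι) (f : OmegaOne.{u} → Option ℕ)
  | pair (a b : Code C)

variable {C : ∀ ξ, SpaceChoice (X ξ)}

namespace PX

/-- The dense set of the conditions that decide whether `r` is in the generic filter. -/
def deciding (r : PX C) : DenseSubset C := by
  refine ⟨{s | s ≤ r ∨ ∀ t ≤ s, ¬ t ≤ r}, fun p => ?_⟩
  by_cases h : ∃ t ≤ p, t ≤ r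
  · obtain ⟨t, htp, htr⟩ := h
    exact ⟨t, Or.inl htr, htp⟩
  · push Not at h
    exact ⟨p, Or.inr h, le_rfl⟩

/-- The point beyond which `p` can be extended into `D` close to any point, for indices in `F`. -/
noncomputable def extensionBound (p : PX C) (D : DenseSubset C) (F : Finset ι) : OmegaOne.{u} :=
  (p.exists_bound_forall_extension D.2 F).choose

open Classical in
/-- A choice of an extension of `p` in `D` such that the new points, for indices in `F`, are in the
`n`-th neighbourhood of `β`. -/
noncomputable def extension (p : PX C) (D : DenseSubset C) (F : Finset ι) (β : OmegaOne.{u})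
    (n : ℕ) : PX C :=
  if h : ∃ r ∈ D.1, r ≤ p ∧ ∀ ξ ∈ F, sectionOf r.a ξ \ sectionOf p.a ξ ⊆ (C ξ).base β n
  then h.choose else p

theorem extension_spec (p : PX C) (D : DenseSubset C) (F : Finset ι) {β : OmegaOne.{u}}
    (hβ : extensionBound p D F < β) (n : ℕ) :
    extension p D F β n ∈ D.1 ∧ extension p D F β n ≤ p ∧ ∀ ξ ∈ F,
      sectionOf (extension p D F β n).a ξ \ sectionOf p.a ξ ⊆ (C ξ).base β n := by
  have h := (p.exists_bound_forall_extension D.2 F).choose_spec β hβ n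
  rw [extension, dif_pos h]
  exact h.choose_spec

end PX

open Classical in
/-- A bound as in `IsSafe.exists_bound`. -/
noncomputable def promiseBound (C : ∀ ξ, SpaceChoice (X ξ)) (v : Finset ι)
    (f : OmegaOne.{u} → Option ℕ) : OmegaOne.{u} :=
  if h : IsSafe C ∧ IsPromise f then (h.1.exists_bound v h.2).choose else Classical.arbitrary _

theorem promiseBound_spec (hC : IsSafe C) {v : Finset ι} {f : OmegaOne.{u} → Option ℕ}
    (hf : IsPromise f) {s : ℕ → OmegaOne.{u}} {x : ∀ ξ, X ξ}
    (hx : ∀ ξ ∈ v, Tendsto (fun n => (C ξ).pt (s n)) atTop (𝓝 (x ξ)))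
    (hs : ∀ᶠ n in atTop, promiseBound C v f < s n) :
    ¬ {α | ∃ n, f α = some n ∧ ∀ ξ ∈ v, x ξ ∈ (C ξ).base α n}.Countable := by
  have h : IsSafe C ∧ IsPromise f := ⟨hC, hf⟩
  rw [promiseBound, dif_pos h] at hs
  exact (h.1.exists_bound v h.2).choose_spec s x hx hs

namespace Code

/-- The dense set that a code stands for. -/
def denseOf : Code C → DenseSubset C
  | dense D => D
  | _ => ⟨Set.univ, fun p => ⟨p, trivial, le_rfl⟩⟩

/-- The first projection. -/
def fstOp (a _b : Code C) : Code C := a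

/-- The successor function on the natural numbers. -/
def succOp : Code C → Code C → Code C
  | nat n, _ => nat (n + 1)
  | _, _ => nat 0

open Classical in
/-- Insertion into a finite set of indices. -/
noncomputable def insertOp : Code C → Code C → Code C
  | idx ξ, fin F => fin (insert ξ F)
  | _, b => b

/-- The choice of extensions. -/
noncomputable def extendOp : Code C → Code C → Code C
  | pair (condition p) w, pair (fin F) (pair (ord β) (nat n)) =>
    condition (p.extension w.denseOf F β n)
  | a, _ => a

open Classical in
/-- The comparison of conditions. -/
noncomputable def compareOp : Code C → Code C → Code C
  | condition p, condition r => if p ≤ r then nat 0 else if ∀ t ≤ p, ¬ t ≤ r then nat 1 else nat 2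
  | _, _ => nat 3

/-- The values of the first coordinate of a condition. -/
def valueOp : Code C → Code C → Code C
  | condition p, pnt z => match p.a z with
    | none => nat 0
    | some false => nat 1
    | some true => nat 2
  | _, _ => nat 3

/-- The objects that are needed together with a given one. -/
def support (E : ∀ ξ, X ξ ≃ OmegaOne.{u}) : Code C → Set (Code C)
  -- The ordinal ensures that a nonempty hull contains at least one countable ordinal.
  | nat _ => {fin ∅, ord (Classical.arbitrary _)}
  | ord α => {ord (exists_gt α).choose}
  | pnt z => {idx z.1, ord (E z.1 z.2)}
  | condition p => pnt '' {z | p.a z ≠ none} ∪ (fun z => prom z.1 z.2) '' p.Φ ∪ {dense p.deciding}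
  | prom v f => idx '' v ∪ {ord (promiseBound C v f)}
  -- Together with the clause for `pnt`, this makes the points of `X ξ` in a hull containing `ξ`
  -- correspond exactly to the countable ordinals of the hull.
  | pair (idx ξ) (ord α) => {pnt ⟨ξ, (E ξ).symm α⟩}
  | pair (pair (condition p) w) (fin F) => {ord (p.extensionBound w.denseOf F)}
  | _ => ∅

theorem countable_support (E : ∀ ξ, X ξ ≃ OmegaOne.{u}) (w : Code C) : (support E w).Countable := by
  unfold support
  split
  · exact Set.Countable.insert _ (Set.countable_singleton _)
  · exact Set.countable_singleton _
  · exact Set.Countable.insert _ (Set.countable_singleton _)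
  · exact (((PX.a_countable _).image _).union ((PX.Φ_countable _).image _)).union
      (Set.countable_singleton _)
  · exact ((Finset.countable_toSet _).image _).union (Set.countable_singleton _)
  · exact Set.countable_singleton _
  · exact Set.countable_singleton _
  · exact Set.countable_empty

theorem exists_enum (E : ∀ ξ, X ξ ≃ OmegaOne.{u}) (w : Code C) :
    ∃ s : ℕ → Code C, insert w (support E w) = Set.range s :=
  ((countable_support E w).insert w).exists_eq_range (Set.insert_nonempty _ _)

/-- The enumeration of `support E w`. -/
noncomputable def enumOp (E : ∀ ξ, X ξ ≃ OmegaOne.{u}) : Code C → Code C → Code C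
  | w, nat n => (exists_enum E w).choose n
  | w, _ => w

/-- The operations under which the submodels are closed. -/
noncomputable def ops (E : ∀ ξ, X ξ ≃ OmegaOne.{u}) : List (Code C → Code C → Code C) :=
  [fstOp, succOp, pair, insertOp, extendOp, compareOp, valueOp, enumOp E]

theorem exists_injective_toZFSet (W : Type u) : ∃ e : W → ZFSet.{u}, Function.Injective e :=
  ⟨fun w => (embeddingToCardinal w).ord.toZFSet, fun _ _ h =>
    embeddingToCardinal.injective (Cardinal.ord_injective (Ordinal.toZFSet_injective h))⟩

end Code

section Closure

open Code

variable {E : ∀ ξ, X ξ ≃ OmegaOne.{u}} {M M' : Set (Code C)} {g : Code C → Code C}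

namespace IsHullIso

theorem nat_mem (H : IsHullIso (ops E) M M' g) {a : Code C} (ha : a ∈ M) (n : ℕ) :
    nat n ∈ M := by
  have hs : ∀ b ∈ M, succOp b b ∈ M := fun b hb => H.op_mem _ (by simp [ops]) b hb b hb
  have h0 : nat 0 ∈ M := hs _ (H.op_mem pair (by simp [ops]) a ha a ha)
  induction n with
  | zero => exact h0
  | succ n ih => exact hs _ ih

/-- A hull contains all natural numbers, so it contains every term of the chosen enumeration: the
usual reason why a countable element of an elementary submodel is a subset of it. -/
theorem support_subset (H : IsHullIso (ops E) M M' g) {w : Code C} (hw : w ∈ M) :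
    support E w ⊆ M := by
  intro a ha
  have h : a ∈ insert w (support E w) := Or.inr ha
  rw [(exists_enum E w).choose_spec] at h
  obtain ⟨n, rfl⟩ := h
  exact H.op_mem (enumOp E) (by simp [ops]) w hw (nat n) (H.nat_mem hw n)

theorem pair_mem (H : IsHullIso (ops E) M M' g) {a b : Code C} (ha : a ∈ M) (hb : b ∈ M) :
    pair a b ∈ M :=
  H.op_mem pair (by simp [ops]) a ha b hb

theorem map_pair (H : IsHullIso (ops E) M M' g) {a b : Code C} (ha : a ∈ M) (hb : b ∈ M) :
    g (pair a b) = pair (g a) (g b) :=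
  H.map_op pair (by simp [ops]) a ha b hb

end IsHullIso

end Closure

end Codes

/-! ### A generic sequence that is small on both sides. -/

section Master

variable {ι : Type u} {X : ι → Type u} [∀ ξ, TopologicalSpace (X ξ)]
variable {C : ∀ ξ, SpaceChoice (X ξ)} {E : ∀ ξ, X ξ ≃ OmegaOne.{u}}

open Code

/-- The action on conditions of a map of codes. -/
def condMap (g : Code C → Code C) (p : PX C) : PX C :=
  match g (condition p) with
  | condition q => q
  | _ => p

open Classical in
/-- The finite set of the indices among the first `n` members of a sequence of codes. -/
noncomputable def indexFinset (w : ℕ → Code C) : ℕ → Finset ι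
  | 0 => ∅
  | n + 1 => match w n with
    | idx ξ => insert ξ (indexFinset w n)
    | _ => indexFinset w n

theorem fin_indexFinset_succ (w : ℕ → Code C) (n : ℕ) :
    (fin (indexFinset w (n + 1)) : Code C) = insertOp (w n) (fin (indexFinset w n)) := by
  rw [indexFinset]
  cases w n <;> rfl

open Classical in
theorem mem_indexFinset {w : ℕ → Code C} {m n : ℕ} {ξ : ι} (hm : w m = idx ξ) (hmn : m < n) :
    ξ ∈ indexFinset w n := by
  induction n with
  | zero => exact absurd hmn (Nat.not_lt_zero _)
  | succ n ih =>
    have h := fin_indexFinset_succ w n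
    rcases Nat.lt_succ_iff_lt_or_eq.1 hmn with h' | rfl
    · have h1 := ih h'
      cases hw : w n <;> simp only [hw, insertOp, fin.injEq] at h <;> rw [h]
      · exact h1
      · exact h1
      · exact Finset.mem_insert_of_mem h1
      all_goals exact h1
    · rw [hm] at h
      simp only [insertOp, fin.injEq] at h
      rw [h]
      exact Finset.mem_insert_self _ _

section Side

variable {M N : Set (Code C)} {g : Code C → Code C}

namespace IsHullIso

/-- Comparing a code with itself gives `nat 0` exactly for conditions, and `g` respects this test.
-/
theorem map_cond (H : IsHullIso (ops E) M N g) {p : PX C} (hp : condition p ∈ M)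
    (h0 : g (nat 0) = nat 0) : g (condition p) = condition (condMap g p) := by
  have h := H.map_op compareOp (by simp [ops]) _ hp _ hp
  have h1 : compareOp (condition p) (condition p) = nat 0 := by simp [compareOp]
  rw [h1, h0] at h
  unfold condMap
  cases hg : g (condition p) <;> simp [hg, compareOp] at h ⊢

theorem fin_empty_mem (H : IsHullIso (ops E) M N g) {a : Code C} (ha : a ∈ M) :
    fin ∅ ∈ M :=
  H.support_subset (H.nat_mem ha 0) (Or.inl rfl)

theorem fin_indexFinset (H : IsHullIso (ops E) M N g) {w : ℕ → Code C} (hw : ∀ n, w n ∈ M)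
    (h0 : g (fin ∅) = fin ∅) (n : ℕ) : fin (indexFinset w n) ∈ M ∧
      g (fin (indexFinset w n)) = fin (indexFinset (fun n => g (w n)) n) := by
  induction n with
  | zero => exact ⟨H.fin_empty_mem (hw 0), h0⟩
  | succ n ih =>
    rw [fin_indexFinset_succ, fin_indexFinset_succ]
    refine ⟨H.op_mem _ (by simp [ops]) _ (hw n) _ ih.1, ?_⟩
    rw [H.map_op _ (by simp [ops]) _ (hw n) _ ih.1, ih.2]

/-- The target of a hull isomorphism is a hull itself. -/
theorem target (H : IsHullIso (ops E) M N g) : IsHullIso (ops E) N N id where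
  countable := H.countable'
  op_mem := H.op_mem'
  map_op _ _ _ _ _ _ := rfl
  image_eq := Set.image_id _
  fix _ _ _ := rfl

end IsHullIso

end Side

/-- Extensions that are simultaneously small on both sides. -/
theorem exists_small_extension {M : Set (Code C)} {Ms : Bool → Set (Code C)}
    {g : Bool → Code C → Code C} (H : ∀ b, IsHullIso (ops E) M (Ms b) (g b))
    (hnat : ∀ b n, nat n ∈ M → g b (nat n) = nat n)
    (hord : ∀ b α, ord α ∈ M → g b (ord α) = ord α) (hordM : ∀ b α, ord α ∈ Ms b → ord α ∈ M)
    (hfin : ∀ b, g b (fin ∅) = fin ∅)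
    {w : ℕ → Code C} (hw : ∀ n, w n ∈ M) {s : ℕ → OmegaOne.{u}} (hsM : ∀ n, ord (s n) ∈ M)
    (hs : ∀ α, ord α ∈ M → ∀ᶠ n in atTop, α < s n) {x : ∀ ξ, X ξ}
    {U : ∀ ξ, ℕ → Set (X ξ)} (hU : ∀ ξ, (𝓝 (x ξ)).HasAntitoneBasis (U ξ)) (n k : ℕ)
    (hx : ∀ b, ∀ ξ ∈ indexFinset (fun n => g b (w n)) n,
      Tendsto (fun n => (C ξ).pt (s n)) atTop (𝓝 (x ξ)))
    {p : PX C} (hp : condition p ∈ M) :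
    ∃ r, condition r ∈ M ∧ ∀ b, condMap (g b) r ∈ (g b (w n)).denseOf.1 ∧
      condMap (g b) r ≤ condMap (g b) p ∧
      ∀ ξ ∈ indexFinset (fun n => g b (w n)) n,
        sectionOf (condMap (g b) r).a ξ \ sectionOf (condMap (g b) p).a ξ ⊆ U ξ k := by
  have hgp := fun b => (H b).map_cond hp (hnat b 0 ((H b).nat_mem hp 0))
  have hF := fun b => (H b).fin_indexFinset hw (hfin b) n
  -- The bound for the image side is computed in `Ms b`, but its value is a countable ordinal and
  -- therefore lies in `M`, below the tail of `s`.
  have hγ : ∀ b, ord ((condMap (g b) p).extensionBound (g b (w n)).denseOf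
      (indexFinset (fun n => g b (w n)) n)) ∈ M := by
    intro b
    have h1 : pair (pair (condition (condMap (g b) p)) (g b (w n)))
        (fin (indexFinset (fun n => g b (w n)) n)) ∈ Ms b := by
      rw [← hgp b, ← (hF b).2]
      exact (H b).target.pair_mem ((H b).target.pair_mem ((H b).mapsTo hp) ((H b).mapsTo (hw n)))
        ((H b).mapsTo (hF b).1)
    exact hordM b _ ((H b).target.support_subset h1 rfl)
  -- The limits and the sets `U` need not be visible in `M`. A basic neighbourhood of `pt (s i)`
  -- inside `U` is, through the codes of `s i` and `j`.
  have hnear : ∀ b, ∀ᶠ i in atTop, ∀ ξ ∈ indexFinset (fun n => g b (w n)) n,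
      U ξ k ∈ 𝓝 ((C ξ).pt (s i)) := by
    intro b
    rw [Filter.eventually_all_finset]
    intro ξ hξ
    have := eventually_mem_nhds_iff.2 ((hU ξ).mem k)
    exact ((hx b ξ hξ).eventually this)
  obtain ⟨i, hi⟩ := (((hs _ (hγ true)).and (hs _ (hγ false))).and
    ((hnear true).and (hnear false))).exists
  have hiγ : ∀ b, (condMap (g b) p).extensionBound (g b (w n)).denseOf
      (indexFinset (fun n => g b (w n)) n) < s i := fun b => by
    cases b
    exacts [hi.1.2, hi.1.1]
  have hiU : ∀ b, ∀ ξ ∈ indexFinset (fun n => g b (w n)) n, U ξ k ∈ 𝓝 ((C ξ).pt (s i)) :=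
    fun b => by
      cases b
      exacts [hi.2.2, hi.2.1]
  have hj : ∀ b, ∀ᶠ j in atTop, ∀ ξ ∈ indexFinset (fun n => g b (w n)) n,
      (C ξ).base (s i) j ⊆ U ξ k := by
    intro b
    rw [Filter.eventually_all_finset]
    intro ξ hξ
    obtain ⟨j, -, hj⟩ := ((C ξ).base_hasBasis (s i)).mem_iff.1 (hiU b ξ hξ)
    filter_upwards [eventually_ge_atTop j] with j' hj'
      using ((C ξ).base_antitone (s i) hj').trans hj
  obtain ⟨j, hj1, hj2⟩ := ((hj true).and (hj false)).exists
  have hjb : ∀ b, ∀ ξ ∈ indexFinset (fun n => g b (w n)) n, (C ξ).base (s i) j ⊆ U ξ k :=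
    fun b => by
      cases b
      exacts [hj2, hj1]
  have hnj : nat j ∈ M := (H true).nat_mem hp j
  have hH := H true
  have m1 := hH.pair_mem hp (hw n)
  have m2 := hH.pair_mem (hsM i) hnj
  have m3 := hH.pair_mem (hF true).1 m2
  refine ⟨p.extension (w n).denseOf (indexFinset w n) (s i) j,
    hH.op_mem extendOp (by simp [ops]) _ m1 _ m3, fun b => ?_⟩
  -- `g b` fixes `s i` and `j` and commutes with the choice of extensions, so the image is itself a
  -- chosen small extension.
  have hr : condMap (g b) (p.extension (w n).denseOf (indexFinset w n) (s i) j) =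
      (condMap (g b) p).extension (g b (w n)).denseOf (indexFinset (fun n => g b (w n)) n)
        (s i) j := by
    have h := (H b).map_op extendOp (by simp [ops]) _ m1 _ m3
    rw [(H b).map_pair hp (hw n), (H b).map_pair (hF true).1 m2, (H b).map_pair (hsM i) hnj,
      hgp b, (hF b).2, hord b _ (hsM i), hnat b _ hnj] at h
    simp only [extendOp] at h
    rw [condMap, h]
  rw [hr]
  obtain ⟨h1, h2, h3⟩ := (condMap (g b) p).extension_spec (g b (w n)).denseOf
    (indexFinset (fun n => g b (w n)) n) (hiγ b) j
  exact ⟨h1, h2, fun ξ hξ => (h3 ξ hξ).trans (hjb b ξ hξ)⟩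

/-- The order puts the promise restricted to `Y v f q p` into `q.Φ`, so its bound belongs to the
hull and the limit is not banned by it. Using the restriction rather than `f` keeps the surviving
`α` inside `Y v f q p`. -/
theorem eventually_not_countable_promise (hC : IsSafe C) {N N' : Set (Code C)}
    {g : Code C → Code C} (H : IsHullIso (ops E) N N' g) {s : ℕ → OmegaOne.{u}}
    (hs : ∀ α, ord α ∈ N → ∀ᶠ n in atTop, α < s n) {x : ∀ ξ, X ξ}
    (hx : ∀ ξ, idx ξ ∈ N → Tendsto (fun n => (C ξ).pt (s n)) atTop (𝓝 (x ξ)))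
    {U : ∀ ξ, ℕ → Set (X ξ)} (hU : ∀ ξ, (𝓝 (x ξ)).HasAntitoneBasis (U ξ)) {q p : PX C}
    (hq : condition q ∈ N) (hqp : q ≤ p) {v : Finset ι} {f : OmegaOne.{u} → Option ℕ}
    (hf : (v, f) ∈ p.Φ) :
    ∀ᶠ k in atTop, ¬ {α | α ∈ PX.Y v f q p ∧
      ∃ j, f α = some j ∧ ∀ ξ ∈ v, U ξ k ⊆ (C ξ).base α j}.Countable := by
  have hf' := (hqp.2.2 v f hf).2
  have hprom : prom v (restrictTo f (PX.Y v f q p)) ∈ N :=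
    H.support_subset hq (Or.inl (Or.inr ⟨_, hf', rfl⟩))
  have hv : ∀ ξ ∈ v, idx ξ ∈ N := fun ξ hξ =>
    H.support_subset hprom (Or.inl ⟨ξ, hξ, rfl⟩)
  have hb : ord (promiseBound C v (restrictTo f (PX.Y v f q p))) ∈ N :=
    H.support_subset hprom (Or.inr rfl)
  obtain ⟨k₀, hk₀⟩ := exists_basis_subset_uncountable (fun ξ _ => hU ξ)
    (promiseBound_spec hC (q.Φ_promise _ hf') (fun ξ hξ => hx ξ (hv ξ hξ)) (hs _ hb))
  filter_upwards [eventually_ge_atTop k₀] with k hk hc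
  refine hk₀ k hk (hc.mono ?_)
  rintro α ⟨j, hj, hα⟩
  by_cases hY : α ∈ PX.Y v f q p
  · exact ⟨hY, j, by simpa [restrictTo, hY] using hj, hα⟩
  · simp [restrictTo, hY] at hj

/-- A stage of the construction of a generic sequence: the current condition, the current size of
the neighbourhoods of the limit points, and the previous conditions. -/
structure FusionState (C : ∀ ξ, SpaceChoice (X ξ)) : Type u where
  cur : PX C
  size : ℕ
  hist : List (PX C)

/-- The enumeration `w` does the bookkeeping for dense sets, indices and promises. Each stage faces
only finitely many tasks, so one neighbourhood size suits them all before the next extension is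
chosen. -/
theorem exists_generic_sequence (hC : IsSafe C) {M : Set (Code C)} {Ms : Bool → Set (Code C)}
    {g : Bool → Code C → Code C} (H : ∀ b, IsHullIso (ops E) M (Ms b) (g b))
    (hnat : ∀ b n, nat n ∈ M → g b (nat n) = nat n)
    (hord : ∀ b α, ord α ∈ M → g b (ord α) = ord α) (hordM : ∀ b α, ord α ∈ Ms b → ord α ∈ M)
    (hfin : ∀ b, g b (fin ∅) = fin ∅)
    {w : ℕ → Code C} (hw : Set.range w = M) {s : ℕ → OmegaOne.{u}} (hsM : ∀ n, ord (s n) ∈ M)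
    (hs : ∀ α, ord α ∈ M → ∀ᶠ n in atTop, α < s n) {x : ∀ ξ, X ξ}
    (hx : ∀ b ξ, idx ξ ∈ Ms b → Tendsto (fun n => (C ξ).pt (s n)) atTop (𝓝 (x ξ)))
    {U : ∀ ξ, ℕ → Set (X ξ)} (hU : ∀ ξ, (𝓝 (x ξ)).HasAntitoneBasis (U ξ))
    {p₀ : PX C} (hp₀ : condition p₀ ∈ M) :
    ∃ (p : ℕ → PX C) (k : ℕ → ℕ), p 0 = p₀ ∧ (∀ n, condition (p n) ∈ M) ∧ Monotone k ∧
      (∀ n, n ≤ k n) ∧ ∀ b, ∀ n,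
        condMap (g b) (p (n + 1)) ∈ (g b (w n)).denseOf.1 ∧
        condMap (g b) (p (n + 1)) ≤ condMap (g b) (p n) ∧
        (∀ ξ ∈ indexFinset (fun n => g b (w n)) n,
          sectionOf (condMap (g b) (p (n + 1))).a ξ \ sectionOf (condMap (g b) (p n)).a ξ ⊆
            U ξ (k n)) ∧
        ∀ m ≤ n, ∀ t ≤ n, ∀ v f, g b (w t) = prom v f → (v, f) ∈ (condMap (g b) (p m)).Φ →
          ¬ {α | α ∈ PX.Y v f (condMap (g b) (p n)) (condMap (g b) (p m)) ∧
            ∃ j, f α = some j ∧ ∀ ξ ∈ v, U ξ (k n) ⊆ (C ξ).base α j}.Countable := by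
  classical
  have hwM : ∀ n, w n ∈ M := fun n => hw ▸ ⟨n, rfl⟩
  have hidx : ∀ b n, ∀ ξ ∈ indexFinset (fun n => g b (w n)) n, idx ξ ∈ Ms b := by
    intro b n
    induction n with
    | zero => simp [indexFinset]
    | succ n ih =>
      intro ξ hξ
      have hm := (H b).mapsTo (hwM n)
      rw [indexFinset] at hξ
      split at hξ
      · next η hη =>
        rcases Finset.mem_insert.1 hξ with rfl | h
        · rwa [hη] at hm
        · exact ih ξ h
      · exact ih ξ hξ
  have hcond : ∀ b p, condition p ∈ M → condition (condMap (g b) p) ∈ Ms b := by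
    intro b p hp
    rw [← (H b).map_cond hp (hnat b 0 ((H b).nat_mem hp 0))]
    exact (H b).mapsTo hp
  let Inv : FusionState C → Prop := fun σ => condition σ.cur ∈ M ∧
    ∀ p ∈ σ.hist, ∀ b, condMap (g b) σ.cur ≤ condMap (g b) p
  let R : ℕ → FusionState C → FusionState C → Prop := fun n σ τ =>
    τ.hist = σ.cur :: σ.hist ∧ σ.size ≤ τ.size ∧ n ≤ τ.size ∧ ∀ b,
      condMap (g b) τ.cur ∈ (g b (w n)).denseOf.1 ∧
      condMap (g b) τ.cur ≤ condMap (g b) σ.cur ∧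
      (∀ ξ ∈ indexFinset (fun n => g b (w n)) n,
        sectionOf (condMap (g b) τ.cur).a ξ \ sectionOf (condMap (g b) σ.cur).a ξ ⊆
          U ξ τ.size) ∧
      ∀ p ∈ τ.hist, ∀ t ≤ n, ∀ v f, g b (w t) = prom v f → (v, f) ∈ (condMap (g b) p).Φ →
        ¬ {α | α ∈ PX.Y v f (condMap (g b) σ.cur) (condMap (g b) p) ∧
          ∃ j, f α = some j ∧ ∀ ξ ∈ v, U ξ τ.size ⊆ (C ξ).base α j}.Countable
  have hstep : ∀ n (σ : {σ // Inv σ}), ∃ τ : {σ // Inv σ}, R n σ.1 τ.1 := by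
    rintro n ⟨⟨q, k, l⟩, hq, hl⟩
    dsimp only at hq hl
    have hl' : ∀ p ∈ q :: l, ∀ b, condMap (g b) q ≤ condMap (g b) p := by
      intro p hp b
      rcases List.mem_cons.1 hp with rfl | hp
      · exact le_rfl
      · exact hl p hp b
    have hev : ∀ᶠ k' in atTop, ∀ b, ∀ p ∈ {p | p ∈ q :: l}, ∀ t ∈ Set.Iic n, ∀ v f,
        g b (w t) = prom v f → (v, f) ∈ (condMap (g b) p).Φ →
        ¬ {α | α ∈ PX.Y v f (condMap (g b) q) (condMap (g b) p) ∧
          ∃ j, f α = some j ∧ ∀ ξ ∈ v, U ξ k' ⊆ (C ξ).base α j}.Countable := by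
      rw [Filter.eventually_all]
      intro b
      rw [Filter.eventually_all_finite (List.finite_toSet _)]
      intro p hp
      rw [Filter.eventually_all_finite (Set.finite_Iic n)]
      intro t _
      by_cases h : ∃ v f, g b (w t) = prom v f ∧ (v, f) ∈ (condMap (g b) p).Φ
      · obtain ⟨v, f, hvf, hf⟩ := h
        filter_upwards [eventually_not_countable_promise hC (H b).target
          (fun α hα => hs α (hordM b α hα)) (hx b) hU (hcond b q hq) (hl' p hp b) hf]
          with k' hk' v' f' hvf' hf'
        rw [hvf, prom.injEq] at hvf'
        obtain ⟨rfl, rfl⟩ := hvf'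
        exact hk'
      · exact Eventually.of_forall fun k' v f h1 h2 => absurd ⟨v, f, h1, h2⟩ h
    obtain ⟨k', ⟨h1, h2⟩, h3⟩ :=
      (((eventually_ge_atTop k).and (eventually_ge_atTop n)).and hev).exists
    obtain ⟨r, hr, hr'⟩ := exists_small_extension H hnat hord hordM hfin hwM hsM hs hU n k'
      (fun b ξ hξ => hx b ξ (hidx b n ξ hξ)) hq
    exact ⟨⟨⟨r, k', q :: l⟩, hr, fun p hp b => (hr' b).2.1.trans (hl' p hp b)⟩, rfl, h1, h2,
      fun b => ⟨(hr' b).1, (hr' b).2.1, (hr' b).2.2, h3 b⟩⟩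
  choose next hnext using hstep
  let st : ℕ → {σ // Inv σ} := fun n =>
    Nat.rec ⟨⟨p₀, 0, []⟩, hp₀, by simp⟩ (fun n σ => next n σ) n
  have hst : ∀ n, R n (st n).1 (st (n + 1)).1 := fun n => hnext n (st n)
  have hhist : ∀ n m, m ≤ n → (st m).1.cur ∈ (st (n + 1)).1.hist := by
    intro n
    induction n with
    | zero =>
      intro m hm
      obtain rfl := Nat.le_zero.1 hm
      rw [(hst 0).1]
      exact List.mem_cons_self
    | succ n ih =>
      intro m hm
      rw [(hst (n + 1)).1]
      rcases Nat.le_succ_iff.1 hm with h | rfl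
      · exact List.mem_cons_of_mem _ (ih m h)
      · exact List.mem_cons_self
  refine ⟨fun n => (st n).1.cur, fun n => (st (n + 1)).1.size, rfl, fun n => (st n).2.1,
    monotone_nat_of_le_succ fun n => (hst (n + 1)).2.1, fun n => (hst n).2.2.1, fun b n => ?_⟩
  obtain ⟨h1, h2, h3, h4⟩ := (hst n).2.2.2 b
  exact ⟨h1, h2, h3, fun m hm => h4 _ (hhist n m hm)⟩

end Master

/-! ### A generic condition common to both hulls. -/

section Generic

variable {ι : Type u} {X : ι → Type u} [∀ ξ, TopologicalSpace (X ξ)]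
variable {C : ∀ ξ, SpaceChoice (X ξ)} {E : ∀ ξ, X ξ ≃ OmegaOne.{u}}

open Code

/-- A hull contains a sequence of countable ordinals that is cofinal in it. -/
theorem exists_cofinal_sequence {M : Set (Code C)} {N : Set (Code C)} {g : Code C → Code C}
    (H : IsHullIso (ops E) M N g) (hM : M.Nonempty) :
    ∃ s : ℕ → OmegaOne.{u}, (∀ n, ord (s n) ∈ M) ∧
      ∀ α, ord α ∈ M → ∀ᶠ n in atTop, α < s n := by
  let A : Set OmegaOne.{u} := {α | ord α ∈ M}
  have hA : A.Countable := H.countable.preimage fun a b h => by simpa using h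
  have : Countable A := hA
  obtain ⟨a, ha⟩ := hM
  have : Nonempty A := ⟨⟨_, H.support_subset (H.nat_mem ha 0) (Or.inr rfl)⟩⟩
  obtain ⟨s, hs⟩ := exists_seq_tendsto (atTop : Filter A)
  refine ⟨fun n => s n, fun n => (s n).2, fun α hα => ?_⟩
  -- A larger ordinal of the hull turns the weak inequality from cofinality into a strict one.
  have hβ : ord (exists_gt α).choose ∈ M := H.support_subset hα rfl
  filter_upwards [hs.eventually (eventually_ge_atTop (⟨_, hβ⟩ : A))] with n hn
  exact (exists_gt α).choose_spec.trans_le hn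

theorem exists_common_generic [∀ ξ, FirstCountableTopology (X ξ)] [∀ ξ, SeqCompactSpace (X ξ)]
    [∀ ξ, RegularSpace (X ξ)] (hC : IsSafe C) {M M' : Set (Code C)} {h : Code C → Code C}
    (H : IsHullIso (ops E) M M' h) (hordM : ∀ α, ord α ∈ M ↔ ord α ∈ M')
    {p₀ : PX C} (hp₀ : condition p₀ ∈ M) :
    ∃ q ≤ p₀, (∀ D : DenseSubset C, dense D ∈ M → ∃ d ∈ D.1, condition d ∈ M ∧ q ≤ d) ∧
      ∀ r r', condition r ∈ M → h (condition r) = condition r' →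
        (q ≤ r ∧ q ≤ r') ∨ ∀ t ≤ q, ¬ t ≤ r ∧ ¬ t ≤ r' := by
  have hne : ∀ ξ, Nonempty (X ξ) := fun ξ => ⟨(C ξ).pt (Classical.arbitrary _)⟩
  -- `false` is the original side with the identity map, `true` its image under `h`.
  let Ms : Bool → Set (Code C) := fun b => bif b then M' else M
  let g : Bool → Code C → Code C := fun b => bif b then h else id
  have Hs : ∀ b, IsHullIso (ops E) M (Ms b) (g b) := by
    intro b
    cases b
    · exact ⟨H.countable, H.op_mem, fun _ _ _ _ _ _ => rfl, Set.image_id _, fun _ _ _ => rfl⟩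
    · exact H
  have hM : M.Nonempty := ⟨_, hp₀⟩
  have hnatM : ∀ n, nat n ∈ M := H.nat_mem hp₀
  have hp₀' := H.mapsTo hp₀
  have hnat' : ∀ n, h (nat n) = nat n := fun n => H.fix _ (hnatM n) (H.target.nat_mem hp₀' n)
  have hfin' : h (fin ∅) = fin ∅ :=
    H.fix _ (H.fin_empty_mem hp₀) (H.target.fin_empty_mem hp₀')
  have hnat : ∀ b n, nat n ∈ M → g b (nat n) = nat n := by
    rintro (_ | _) n -
    exacts [rfl, hnat' n]
  have hord : ∀ b α, ord α ∈ M → g b (ord α) = ord α := by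
    rintro (_ | _) α hα
    exacts [rfl, H.fix _ hα ((hordM α).1 hα)]
  have hordMs : ∀ b α, ord α ∈ Ms b ↔ ord α ∈ M := by
    rintro (_ | _) α
    exacts [Iff.rfl, (hordM α).symm]
  have hfin : ∀ b, g b (fin ∅) = fin ∅ := by
    rintro (_ | _)
    exacts [rfl, hfin']
  obtain ⟨w, hw⟩ := H.countable.exists_eq_range hM
  have hwM : ∀ n, w n ∈ M := fun n => hw ▸ ⟨n, rfl⟩
  have hgw : ∀ b, Set.range (fun n => g b (w n)) = Ms b := by
    intro b
    rw [← (Hs b).image_eq, hw, ← Set.range_comp]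
    rfl
  obtain ⟨s₀, hs₀M, hs₀⟩ := exists_cofinal_sequence H hM
  let I : Bool → Set ι := fun b => {ξ | idx ξ ∈ Ms b}
  have hI : (⋃ b, I b).Countable := Set.countable_iUnion fun b =>
    (Hs b).countable'.preimage fun a b h => by simpa using h
  obtain ⟨φ, x, hφ, hx⟩ := exists_strictMono_forall_tendsto hI fun ξ n => (C ξ).pt (s₀ n)
  choose U hU using fun ξ => (𝓝 (x ξ)).exists_antitone_basis
  obtain ⟨p, k, hp0, hpM, hk, hk', hp⟩ := exists_generic_sequence hC Hs hnat hord
    (fun b α => (hordMs b α).1) hfin hw.symm (fun n => hs₀M (φ n))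
    (fun α hα => hφ.tendsto_atTop.eventually (hs₀ α hα))
    (fun b ξ hξ => hx ξ (Set.mem_iUnion.2 ⟨b, hξ⟩)) hU hp₀
  have hcond : ∀ b n, condition (condMap (g b) (p n)) ∈ Ms b := by
    intro b n
    rw [← (Hs b).map_cond (hpM n) (hnat b 0 (hnatM 0))]
    exact (Hs b).mapsTo (hpM n)
  have hpnt : ∀ b n z, (condMap (g b) (p n)).a z ≠ none → pnt z ∈ Ms b := fun b n z hz =>
    (Hs b).target.support_subset (hcond b n) (Or.inl (Or.inl ⟨z, hz, rfl⟩))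
  have hdom : ∀ b n ξ y, (condMap (g b) (p n)).a ⟨ξ, y⟩ ≠ none → ξ ∈ I b := fun b n ξ y hz =>
    (Hs b).target.support_subset (hpnt b n _ hz) (Or.inl rfl)
  have hval : ∀ n z, pnt z ∈ M → pnt z ∈ M' →
      (condMap (g true) (p n)).a z = (condMap (g false) (p n)).a z := by
    intro n z hz hz'
    have h1 := H.map_op valueOp (by simp [ops]) _ (hpM n) _ hz
    rw [H.fix _ hz hz', H.map_cond (hpM n) (hnat' 0)] at h1
    change (condMap h (p n)).a z = (p n).a z
    revert h1
    simp only [valueOp]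
    generalize (condMap h (p n)).a z = c
    generalize (p n).a z = d
    rcases d with _ | _ | _ <;> rcases c with _ | _ | _ <;> simp [hnat']
  -- A point on one side over an index of the other side is coded by a common ordinal, so it lies in
  -- both hulls and `h` fixes it; both conditions then have the same value there.
  have hcoh : ∀ b n ξ y c, ξ ∈ I b → (condMap (g !b) (p n)).a ⟨ξ, y⟩ = some c →
      (condMap (g b) (p n)).a ⟨ξ, y⟩ = some c := by
    intro b n ξ y c hξ hc
    have hz : pnt ⟨ξ, y⟩ ∈ Ms !b := hpnt _ n _ (by simp [hc])
    have ho : ord (E ξ y) ∈ Ms b :=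
      (hordMs _ _).2 ((hordMs _ _).1 ((Hs _).target.support_subset hz (Or.inr rfl)))
    have hz' : pnt ⟨ξ, y⟩ ∈ Ms b := by
      have := (Hs b).target.support_subset ((Hs b).target.pair_mem hξ ho)
        (Set.mem_singleton _)
      rwa [Equiv.symm_apply_apply] at this
    cases b
    · rw [← hval n _ hz' hz]
      exact hc
    · rw [hval n _ hz hz']
      exact hc
  obtain ⟨q, hq⟩ := PX.exists_fusion (p := fun b n => condMap (g b) (p n))
    (fun b n => (hp b n).2.1) hdom hcoh (fun ξ => (hU ξ).antitone)
    (fun ξ => by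
      obtain ⟨V, hV, hV'⟩ :=
        (C ξ).filt_maximal.1.exists_nhds_notMem (C ξ).filt_not_fixed (x ξ)
      obtain ⟨k, hk⟩ := (hU ξ).mem_iff.1 hV
      exact ⟨k, (C ξ).filt_maximal.1.notMem_mono hk hV'⟩)
    hk hk' (F := fun b n => indexFinset (fun n => g b (w n)) n)
    (fun b ξ hξ => by
      have hξ' : idx ξ ∈ Set.range (fun n => g b (w n)) := hgw b ▸ hξ
      obtain ⟨m, hm⟩ := hξ'
      filter_upwards [eventually_gt_atTop m] with n hn using mem_indexFinset hm hn)
    (fun b n => (hp b n).2.2.1)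
    (fun b n v f hf => by
      have hv : prom v f ∈ Ms b :=
        (Hs b).target.support_subset (hcond b n) (Or.inl (Or.inr ⟨_, hf, rfl⟩))
      refine ⟨fun ξ hξ => (Hs b).target.support_subset hv (Or.inl ⟨ξ, hξ, rfl⟩), ?_⟩
      rw [← hgw b] at hv
      obtain ⟨t, ht⟩ := hv
      filter_upwards [eventually_ge_atTop n, eventually_ge_atTop t] with m hnm htm
      exact (hp b m).2.2.2 n hnm t htm v f ht hf)
  have hDp : ∀ D : DenseSubset C, dense D ∈ M → ∃ n, p n ∈ D.1 := by
    intro D hD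
    rw [hw] at hD
    obtain ⟨n, hn⟩ := hD
    have := (hp false n).1
    refine ⟨n + 1, ?_⟩
    change p (n + 1) ∈ (w n).denseOf.1 at this
    rwa [hn] at this
  refine ⟨q, hp0 ▸ hq false 0, fun D hD => ?_, fun r r' hr hrr' => ?_⟩
  · obtain ⟨n, hn⟩ := hDp D hD
    exact ⟨p n, hn, hpM n, hq false n⟩
  -- Some `p n` lies below `r` or is incompatible with it, and `compareOp` transfers the verdict to
  -- the images of `p n` and `r`.
  · obtain ⟨n, hn⟩ := hDp r.deciding (H.support_subset hr (Or.inr rfl))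
    have hq0 : q ≤ p n := hq false n
    have hq1 : q ≤ condMap h (p n) := hq true n
    have h1 := H.map_op compareOp (by simp [ops]) _ (hpM n) _ hr
    rw [hrr', H.map_cond (hpM n) (hnat' 0)] at h1
    by_cases hle : p n ≤ r
    · left
      refine ⟨hq0.trans hle, hq1.trans ?_⟩
      by_contra hle'
      simp only [compareOp, if_pos hle, if_neg hle', hnat'] at h1
      split_ifs at h1 <;> simp at h1
    · have hperp : ∀ t ≤ p n, ¬ t ≤ r := hn.resolve_left hle
      right
      have hperp' : ∀ t ≤ condMap h (p n), ¬ t ≤ r' := by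
        by_contra hc
        simp only [compareOp, if_neg hle, if_pos hperp, hnat', if_neg hc] at h1
        split_ifs at h1 <;> simp at h1
      exact fun t ht => ⟨hperp t (ht.trans hq0), hperp' t (ht.trans hq1)⟩

end Generic

/-! ### The isomorphism condition for `P(𝒳)`. -/

theorem mainTheorem8 (CH : Cardinal.continuum.{0} = Cardinal.aleph 1)
    {ι : Type u} (X : ι → Type u) [∀ ξ, TopologicalSpace (X ξ)]
    (hX : ∀ ξ, IsRelevant (X ξ)) (C : ∀ ξ, SpaceChoice (X ξ)) (hsafe : IsSafe C) :
    AlephTwoPIC (PX C) := by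
  have h1 := fun ξ => (hX ξ).firstCountable
  have h2 := fun ξ => (hX ξ).countablyCompact
  have h3 := fun ξ => (hX ξ).regular
  have hE : ∀ ξ, Nonempty (X ξ ≃ OmegaOne.{u}) := fun ξ => by
    rw [← Cardinal.eq, (hX ξ).card_eq, Cardinal.mk_toType, Ordinal.card_omega]
  have E := fun ξ => (hE ξ).some
  intro c hc
  obtain ⟨e, he⟩ := Code.exists_injective_toZFSet (Code C)
  let dc : DenseSubset C → ZFSet.{u} := fun D => codeSet c D.1
  have hdc : Function.Injective dc := by
    intro D D' h
    have key : ∀ D D' : DenseSubset C, dc D = dc D' → D.1 ⊆ D'.1 := by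
      intro D D' h d hd
      have : c d ∈ dc D' := h ▸ ZFSet.mem_range.2 ⟨⟨d, hd⟩, rfl⟩
      obtain ⟨⟨d', hd'⟩, hdd'⟩ := ZFSet.mem_range.1 this
      exact hc hdd' ▸ hd'
    exact Subtype.ext ((key D D' h).antisymm (key D' D h.symm))
  let oc : OmegaOne.{u} → ZFSet.{u} := fun α =>
    (Ordinal.typein (α := OmegaOne.{u}) (· < ·) α).toZFSet
  have hoc : Function.Injective oc := fun α β h =>
    Ordinal.typein_injective _ (Ordinal.toZFSet_injective h)
  have hoc' : ∀ α : OmegaOne.{u}, Ordinal.typein (α := OmegaOne.{u}) (· < ·) α < Ordinal.omega 1 :=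
    fun α => Ordinal.typein_lt_self α
  have eC : Function.Injective fun p => e (Code.condition p : Code C) := fun p q h => by
    simpa using he h
  have eO : Function.Injective fun α => e (Code.ord α : Code C) := fun p q h => by
    simpa using he h
  -- The bridges translate between the given coding of conditions, dense sets and ordinals and the
  -- internal coding `e`.
  let l : List ZFSet.{u} := [(Ordinal.omega 1).toZFSet, bridgeSet c (fun p => e (.condition p)),
    bridgeSet (fun p => e (.condition p)) c, bridgeSet dc (fun D => e (.dense D)),
    bridgeSet oc (fun α => e (.ord α)), bridgeSet (fun α => e (.ord α)) oc] ++
    (Code.ops E).map (graphSet e)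
  -- No lower bound on `κ` is needed: membership of the parameter in the submodels already puts
  -- every set that is used into `H(κ)`.
  refine ⟨tupleSet l, 0, ?_⟩
  intro κ _ _ i j Ni Nj h p hij hj2 hNi hNj hxi hxj hi hj hsup hinit hhij hfix hPi hPj hp
  have hli := mem_elems_of_tupleSet hxi
  have hlj := mem_elems_of_tupleSet hxj
  have hl : ∀ z ∈ l, IsoSends h z z := fun z hz => hfix z (hli z hz) (hlj z hz)
  obtain ⟨g, H, hg⟩ := exists_isHullIso (h := h) he (ops := Code.ops E) (by
      have : (Code.fstOp : Code C → Code C → Code C) ∈ Code.ops E := by simp [Code.ops]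
      exact this)
    (fun F hF => hl _ (List.mem_append_right _ (List.mem_map_of_mem hF))) hNi hfix
  have hω : (Ordinal.omega 1 : Ordinal.{u}) < Ordinal.omega 2 :=
    Ordinal.omega_lt_omega.2 (by norm_num)
  -- `ω₁` lies in both models and below `j`, so it belongs to `N_j ∩ j = N_i ∩ i`. Hence the two
  -- models have the same countable ordinals.
  have hωi : (Ordinal.omega 1 : Ordinal.{u}) < i :=
    ((hinit _).2 ⟨hlj _ (by simp [l]), hsup _ hω (hli _ (by simp [l]))⟩).2
  have hordM : ∀ α : OmegaOne.{u},
      e (.ord α : Code C) ∈ elems Ni ↔ e (.ord α : Code C) ∈ elems Nj := by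
    intro α
    have hα := (hoc' α).trans hωi
    have hαj := hα.trans hij
    have hiff : oc α ∈ elems Ni ↔ oc α ∈ elems Nj := by
      constructor
      · exact fun hα' => ((hinit _).1 ⟨hα', hα⟩).1
      · exact fun hα' => ((hinit _).2 ⟨hα', hαj⟩).1
    constructor
    · intro hα'
      exact mem_elems_of_bridge hoc (hlj (bridgeSet oc fun α => e (.ord α)) (by simp [l]))
        (hiff.1 (mem_elems_of_bridge eO (hli (bridgeSet (fun α => e (.ord α)) oc) (by simp [l]))
          hα'))
    · intro hα'
      exact mem_elems_of_bridge hoc (hli (bridgeSet oc fun α => e (.ord α)) (by simp [l]))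
        (hiff.2 (mem_elems_of_bridge eO (hlj (bridgeSet (fun α => e (.ord α)) oc) (by simp [l]))
          hα'))
  have hcM : ∀ r, c r ∈ elems Ni → e (.condition r : Code C) ∈ elems Ni := fun r hr =>
    mem_elems_of_bridge hc (hli (bridgeSet c fun p => e (.condition p)) (by simp [l])) hr
  obtain ⟨q, hqp, hqD, hqr⟩ := exists_common_generic hsafe H hordM (hcM p hp)
  refine ⟨q, fun r r' hrr' q' hq' => ?_, fun q' hq' => ⟨q', le_rfl, hq'.trans hqp⟩, ?_⟩
  · have hrr := isoSends_bridge hc (hl (bridgeSet c fun p => e (.condition p)) (by simp [l])) hrr'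
    rcases hqr r r' hrr.left_mem (hg _ _ hrr) with ⟨h1, h2⟩ | hperp
    · exact ⟨fun _ q'' hq'' => ⟨q'', le_rfl, (hq''.trans hq').trans h2⟩,
        fun _ q'' hq'' => ⟨q'', le_rfl, (hq''.trans hq').trans h1⟩⟩
    · constructor
      · intro hf
        obtain ⟨s, hs, hsr⟩ := hf q' le_rfl
        exact absurd hsr (hperp s (hs.trans hq')).1
      · intro hf
        obtain ⟨s, hs, hsr⟩ := hf q' le_rfl
        exact absurd hsr (hperp s (hs.trans hq')).2
  · intro D hD hDN q' hq'
    obtain ⟨d, hd, hdM, hqd⟩ := hqD ⟨D, hD⟩ (mem_elems_of_bridge hdc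
      (hli (bridgeSet dc fun D => e (.dense D)) (by simp [l])) hDN)
    exact ⟨d, hd, mem_elems_of_bridge eC
      (hli (bridgeSet (fun p => e (.condition p)) c) (by simp [l])) hdM, q', le_rfl,
      hq'.trans hqd⟩
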